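/- Let $n\in\{2,3\}$, let $N=2^{\lfloor (n+1)/2\rfloor}$, and let $\alpha_1,\dots,\alpha_{n+1}\in\mathbb C^{N\times N}$ be any Hermitian matrices with $\alpha_j\alpha_k+\alpha_k\alpha_j=2\delta_{j,k}\mathbb I_N$ for $1\le j,k\le n+1$. Let $\mathcal D_n u=-i\sum_{j=1}^n\alpha_j\partial_j u$ be the massless Dirac operator on functions $u:\mathbb R^n\to\mathbb C^N$. For every $\gamma>1$ there exist a function $u\in H^1(\mathbb R^n;\mathbb C^N)\cap C^\infty(\mathbb R^n\setminus\{0\};\mathbb C^N)$, not vanishing identically on $\{0<|x|<r\}$ for any $r>0$ (in particular non-trivial), and constants $C_1,C_2,C_3>0$ such that for all $x\in\mathbb R^n\setminus\{0\}$ $$|u(x)|\le C_1\exp\left[-\frac{C_2}{|x|^{2\gamma-2}}\right]$$ and $$|\mathcal D_n u(x)|\le\begin{cases}C_3|x|^{-\gamma}\,|u(x)| & \text{for } n=2,\\ C_3|x|^{-\gamma}\,\bigl|\log|x|\bigr|^3\,|u(x)| & \text{for } n=3.\end{cases}$$ -/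

import Mathlib

open MeasureTheory
open scoped ContDiff Matrix

noncomputable section

/-- The number `N = 2 ^ ⌊(n + 1) / 2⌋` of components of a spinor on `ℝⁿ`. -/
def spinorDim (n : ℕ) : ℕ := 2 ^ ((n + 1) / 2)

/-- The target `ℂᴺ` of spinor fields on `ℝⁿ`, with its Hermitian norm. -/
abbrev Spinor (n : ℕ) : Type := EuclideanSpace ℂ (Fin (spinorDim n))

/-- Dirac matrices in dimension `n`: Hermitian matrices `α₁, …, αₙ, αₙ₊₁ ∈ ℂ^{N × N}` with
`αⱼ αₖ + αₖ αⱼ = 2 δⱼₖ I`. -/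
structure IsDiracMatrices (n : ℕ)
    (α : Fin (n + 1) → Matrix (Fin (spinorDim n)) (Fin (spinorDim n)) ℂ) : Prop where
  isHermitian : ∀ j, (α j).IsHermitian
  anticomm : ∀ j k, α j * α k + α k * α j = if j = k then 2 else 0

/-- The classical partial derivative `∂ⱼ u` at `x`. -/
def partialDeriv {n : ℕ} {F : Type*} [NormedAddCommGroup F] [NormedSpace ℝ F] (j : Fin n)
    (u : EuclideanSpace ℝ (Fin n) → F) (x : EuclideanSpace ℝ (Fin n)) : F :=
  fderiv ℝ u x (EuclideanSpace.single j 1)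

/-- The massless Dirac operator `𝓓ₙ u = -i ∑_{j = 1}^{n} αⱼ ∂ⱼ u`, evaluated at a point where `u`
is differentiable. -/
def diracOp {n : ℕ} (α : Fin (n + 1) → Matrix (Fin (spinorDim n)) (Fin (spinorDim n)) ℂ)
    (u : EuclideanSpace ℝ (Fin n) → Spinor n) (x : EuclideanSpace ℝ (Fin n)) : Spinor n :=
  (-Complex.I) • ∑ j : Fin n, WithLp.toLp 2 (α j.castSucc *ᵥ (partialDeriv j u x).ofLp)

/-- `g` is the weak partial derivative `∂ⱼ u` on `ℝⁿ`, tested against real `C_c^∞` functions. -/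
def IsWeakPartialDeriv {n : ℕ} {F : Type*} [NormedAddCommGroup F] [NormedSpace ℝ F] (j : Fin n)
    (u g : EuclideanSpace ℝ (Fin n) → F) : Prop :=
  ∀ φ : EuclideanSpace ℝ (Fin n) → ℝ, ContDiff ℝ ∞ φ → HasCompactSupport φ →
    ∫ x, partialDeriv j φ x • u x = - ∫ x, φ x • g x

/-- `u ∈ H¹(ℝⁿ; F)`: `u` and its weak first partial derivatives are square integrable. -/
def MemH1 {n : ℕ} {F : Type*} [NormedAddCommGroup F] [NormedSpace ℝ F]
    (u : EuclideanSpace ℝ (Fin n) → F) : Prop :=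
  MemLp u 2 volume ∧
    ∀ j : Fin n, ∃ g : EuclideanSpace ℝ (Fin n) → F,
      MemLp g 2 volume ∧ IsWeakPartialDeriv j u g

end

/-!
The construction is of Meshkov type: near the origin the solution runs through a sequence of stages,
in each of which it is an exact null solution of the Dirac operator that vanishes at the origin to a
higher order than in the stage before, and consecutive stages are glued by cutoff functions.

**Null solutions from vector fields.** Fix a spinor `v` and write `slash α v ξ = ∑ⱼ ξⱼ αⱼ v` for a
real vector `ξ`. If the vector field `F` is divergence free and curl free, then `slash α v F` is
annihilated by `𝓓`, and a cutoff `φ` produces only the term `-i slash (slash v F) (∇φ)`, of size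
`|∇φ| |F| |v|` (`sum_gammaOp_slash_smul`). The extra Dirac matrix `β = αₙ₊₁` yields a unit spinor `e ⟂ β e`
(`exists_inner_gammaOp_last_eq_zero`), and the fields carried by `e` and by `β e` are pointwise
orthogonal over the reals, whatever their directions (`norm_sq_slash_add_slash`). Consecutive stages
are carried alternately by `e` and `β e`, hence cannot cancel.

**The fields.** The field `axialField a m` is the normalized gradient of the zonal harmonic of
degree `m + 1` about the axis `a`. In the plane spanned by the axis and `x`, its two coefficients of degree
`m + 1` arise from those of degree `m` by a rotation and the dilation by `|x|`, up to a factor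
`κ = (m + 1) / (m + n - 1)` on one of them. So for `n ≤ 3` the angular profile, although it is far
from constant on the sphere when `n = 3`, changes only by a bounded factor when the degree rises
from `m` to `m + k` with `k` at most comparable to `m` (`norm_axialField_add_le`,
`le_norm_axialField_add`).

**The gluing.** Put `s(x) = (e |x|) ^ (1 - γ)`, so that `|∇s|` is of order `|x| ^ (-γ)`. Stage `k ≥ 1`
has degree `(k + 1)²` and hands over to stage `k + 1` while `s` runs through `[k + 1, k + 2]`. Across
this annulus `|x|` changes by a factor `1 + O(1 / k)` and the degree by `2 k + 3`, so with balanced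
amplitudes both stages stay of comparable size there (`exists_profile_comparable`), and `|𝓓 u|` is
bounded by a multiple of `|∇s| |u|`. The amplitudes multiply up to `|u| ≤ C exp (-c s²)`
(`amplitude_mul_pow_le`), which is the asserted decay because `s²` is a multiple of
`|x| ^ (2 - 2 γ)`; the same factor absorbs the polynomial losses in the gradient of `u`.

All transitions take place in `|x| ≤ 1 / e`, where `|log |x|| ≥ 1`, so that the bound for `n = 2`
implies the one for `n = 3`. Outside, `u` is the exact null solution built from
`∇(⟪a, x⟫ / |x|ⁿ)`, which is square integrable at infinity together with its gradient.
-/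

/-! ### Clifford multiplication -/

section Clifford

variable {n : ℕ} {α : Fin (n + 1) → Matrix (Fin (spinorDim n)) (Fin (spinorDim n)) ℂ}

/-- The matrix `αⱼ` as a bounded operator on spinors. -/
noncomputable def gammaOp (α : Fin (n + 1) → Matrix (Fin (spinorDim n)) (Fin (spinorDim n)) ℂ)
    (j : Fin (n + 1)) : Spinor n →L[ℂ] Spinor n :=
  Matrix.toEuclideanCLM (n := Fin (spinorDim n)) (𝕜 := ℂ) (α j)

/-- Clifford multiplication `ξ ↦ ∑ⱼ ξⱼ αⱼ v` of a fixed spinor `v` by real vectors. -/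
noncomputable def slash (α : Fin (n + 1) → Matrix (Fin (spinorDim n)) (Fin (spinorDim n)) ℂ)
    (v : Spinor n) : EuclideanSpace ℝ (Fin n) →L[ℝ] Spinor n :=
  ∑ j : Fin n, (EuclideanSpace.proj j : EuclideanSpace ℝ (Fin n) →L[ℝ] ℝ).smulRight
    (gammaOp α j.castSucc v)

lemma slash_apply (v : Spinor n) (ξ : EuclideanSpace ℝ (Fin n)) :
    slash α v ξ = ∑ j : Fin n, ξ j • gammaOp α j.castSucc v := by
  simp [slash]

lemma gammaOp_real_smul (j : Fin (n + 1)) (c : ℝ) (v : Spinor n) :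
    gammaOp α j (c • v) = c • gammaOp α j v :=
  (gammaOp α j).map_smul_of_tower c v

lemma gammaOp_anticomm (hα : IsDiracMatrices n α) (j k : Fin (n + 1)) (v : Spinor n) :
    gammaOp α j (gammaOp α k v) + gammaOp α k (gammaOp α j v) =
      if j = k then (2 : ℝ) • v else 0 := by
  have h := congrArg (fun M => Matrix.toEuclideanCLM (n := Fin (spinorDim n)) (𝕜 := ℂ) M v)
    (hα.anticomm j k)
  simp only [map_add, map_mul] at h
  change gammaOp α j (gammaOp α k v) + gammaOp α k (gammaOp α j v) = _ at h
  rw [h]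
  split_ifs
  · have h2 : Matrix.toEuclideanCLM (n := Fin (spinorDim n)) (𝕜 := ℂ)
        (2 : Matrix (Fin (spinorDim n)) (Fin (spinorDim n)) ℂ) = 1 + 1 := by
      rw [one_add_one_eq_two]
      exact map_ofNat _ 2
    rw [h2, two_smul]
    rfl
  · simp

lemma gammaOp_sq (hα : IsDiracMatrices n α) (j : Fin (n + 1)) (v : Spinor n) :
    gammaOp α j (gammaOp α j v) = v := by
  have h := gammaOp_anticomm hα j j v
  rw [if_pos rfl, two_smul] at h
  have h2 : (2 : ℝ) • gammaOp α j (gammaOp α j v) = (2 : ℝ) • v := by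
    rw [two_smul, two_smul, h]
  exact smul_right_injective _ (two_ne_zero) h2

lemma gammaOp_swap (hα : IsDiracMatrices n α) {j k : Fin (n + 1)} (hjk : j ≠ k) (v : Spinor n) :
    gammaOp α j (gammaOp α k v) = -gammaOp α k (gammaOp α j v) := by
  have h := gammaOp_anticomm hα j k v
  rw [if_neg hjk] at h
  exact eq_neg_of_add_eq_zero_left h

lemma inner_gammaOp (hα : IsDiracMatrices n α) (j : Fin (n + 1)) (v w : Spinor n) :
    inner ℂ (gammaOp α j v) w = inner ℂ v (gammaOp α j w) := by
  have h : star (gammaOp α j) = gammaOp α j := by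
    have := hα.isHermitian j
    rw [gammaOp, ← map_star, Matrix.star_eq_conjTranspose, this.eq]
  rw [ContinuousLinearMap.star_eq_adjoint] at h
  conv_rhs => rw [← h]
  rw [ContinuousLinearMap.adjoint_inner_right]

lemma inner_slash (hα : IsDiracMatrices n α) (ξ : EuclideanSpace ℝ (Fin n)) (v w : Spinor n) :
    inner ℂ (slash α v ξ) w = inner ℂ v (slash α w ξ) := by
  simp only [slash_apply, sum_inner, inner_sum, inner_smul_left_eq_smul, inner_smul_right_eq_smul,
    inner_gammaOp hα]

/-- Only the trace survives when a symmetric matrix is contracted with the products `αⱼ αₖ`. -/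
lemma sum_gammaOp_slash (hα : IsDiracMatrices n α) (v : Spinor n)
    {b : Fin n → EuclideanSpace ℝ (Fin n)} (hb : ∀ j k, b j k = b k j) :
    ∑ j : Fin n, gammaOp α j.castSucc (slash α v (b j)) = (∑ j, b j j) • v := by
  have hS : ∑ j : Fin n, gammaOp α j.castSucc (slash α v (b j)) =
      ∑ j : Fin n, ∑ k : Fin n, b j k • gammaOp α j.castSucc (gammaOp α k.castSucc v) := by
    simp only [slash_apply, map_sum, gammaOp_real_smul]
  have hS' : ∑ j : Fin n, ∑ k : Fin n, b j k • gammaOp α j.castSucc (gammaOp α k.castSucc v) =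
      ∑ j : Fin n, ∑ k : Fin n, b j k • gammaOp α k.castSucc (gammaOp α j.castSucc v) := by
    rw [Finset.sum_comm]
    exact Finset.sum_congr rfl fun j _ => Finset.sum_congr rfl fun k _ => by rw [hb]
  have h2 : (2 : ℝ) • ∑ j : Fin n, gammaOp α j.castSucc (slash α v (b j)) =
      (2 : ℝ) • ((∑ j, b j j) • v) := by
    rw [two_smul, hS]
    nth_rewrite 2 [hS']
    rw [← Finset.sum_add_distrib, Finset.sum_smul, Finset.smul_sum]
    refine Finset.sum_congr rfl fun j _ => ?_
    rw [← Finset.sum_add_distrib, Finset.sum_eq_single j]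
    · rw [← smul_add, gammaOp_anticomm hα, if_pos rfl, smul_comm]
    · intro k _ hk
      rw [← smul_add, gammaOp_anticomm hα, if_neg, smul_zero]
      exact fun h => hk (Fin.castSucc_injective n h).symm
    · simp
  exact smul_right_injective _ (two_ne_zero) h2

lemma slash_slash_self (hα : IsDiracMatrices n α) (ξ : EuclideanSpace ℝ (Fin n)) (v : Spinor n) :
    slash α (slash α v ξ) ξ = ‖ξ‖ ^ 2 • v := by
  have h := sum_gammaOp_slash hα v (b := fun j => ξ j • ξ) (fun j k => by simp [mul_comm])
  simp only [map_smul, gammaOp_real_smul] at h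
  rw [slash_apply, h, EuclideanSpace.real_norm_sq_eq]
  simp [pow_two]

lemma norm_slash (hα : IsDiracMatrices n α) (v : Spinor n) (ξ : EuclideanSpace ℝ (Fin n)) :
    ‖slash α v ξ‖ = ‖ξ‖ * ‖v‖ := by
  have h : (‖slash α v ξ‖ : ℂ) ^ 2 = ((‖ξ‖ * ‖v‖ : ℝ) : ℂ) ^ 2 := by
    rw [← Complex.coe_algebraMap, ← inner_self_eq_norm_sq_to_K, inner_slash hα,
      slash_slash_self hα, inner_smul_right_eq_smul, inner_self_eq_norm_sq_to_K]
    simp [mul_pow]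
  have h' : ‖slash α v ξ‖ ^ 2 = (‖ξ‖ * ‖v‖) ^ 2 := by exact_mod_cast h
  exact (sq_eq_sq₀ (norm_nonneg _) (by positivity)).1 h'

lemma norm_gammaOp (hα : IsDiracMatrices n α) (j : Fin (n + 1)) (v : Spinor n) :
    ‖gammaOp α j v‖ = ‖v‖ := by
  have h : (‖gammaOp α j v‖ : ℂ) ^ 2 = (‖v‖ : ℂ) ^ 2 := by
    rw [← Complex.coe_algebraMap, ← inner_self_eq_norm_sq_to_K, inner_gammaOp hα,
      gammaOp_sq hα, inner_self_eq_norm_sq_to_K]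
  have h' : ‖gammaOp α j v‖ ^ 2 = ‖v‖ ^ 2 := by exact_mod_cast h
  exact (sq_eq_sq₀ (norm_nonneg _) (norm_nonneg _)).1 h'

/-- Clifford multiples of `e` and of `β e`, where `β = αₙ₊₁`, are orthogonal over the reals as
soon as `e` is orthogonal to `β e`. -/
lemma re_inner_slash_slash (hα : IsDiracMatrices n α) {e : Spinor n}
    (he : inner ℂ e (gammaOp α (Fin.last n) e) = 0) (ξ η : EuclideanSpace ℝ (Fin n)) :
    (inner ℂ (slash α e ξ) (slash α (gammaOp α (Fin.last n) e) η)).re = 0 := by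
  suffices h : ∀ j k : Fin n, (inner ℂ (gammaOp α k.castSucc e)
      (gammaOp α j.castSucc (gammaOp α (Fin.last n) e))).re = 0 by
    simp only [slash_apply, sum_inner, inner_sum, inner_smul_left_eq_smul,
      inner_smul_right_eq_smul, Complex.re_sum, Complex.smul_re, h, smul_zero,
      Finset.sum_const_zero]
  intro j k
  by_cases hjk : j = k
  · subst hjk
    rw [inner_gammaOp hα, gammaOp_sq hα, he, Complex.zero_re]
  -- for `j ≠ k` the operator `αⱼ αₖ β` is anti-Hermitian
  have hjk' : j.castSucc ≠ k.castSucc := fun h => hjk (Fin.castSucc_injective n h)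
  have hj := (Fin.castSucc_lt_last j).ne
  have hk := (Fin.castSucc_lt_last k).ne
  set β := gammaOp α (Fin.last n)
  have h : inner ℂ (gammaOp α k.castSucc e) (gammaOp α j.castSucc (β e)) =
      -inner ℂ (gammaOp α j.castSucc (β e)) (gammaOp α k.castSucc e) := by
    rw [← inner_gammaOp hα j.castSucc, ← inner_gammaOp hα (Fin.last n),
      gammaOp_swap hα hj.symm, gammaOp_swap hα hk.symm, map_neg, neg_neg, gammaOp_swap hα hjk',
      inner_neg_left, inner_gammaOp hα k.castSucc]
  have hre := congrArg Complex.re h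
  have hsymm := inner_re_symm (𝕜 := ℂ) (gammaOp α k.castSucc e) (gammaOp α j.castSucc (β e))
  simp only [RCLike.re_to_complex] at hsymm
  rw [Complex.neg_re] at hre
  linarith

lemma norm_sq_slash_add_slash (hα : IsDiracMatrices n α) {e : Spinor n} (hne : ‖e‖ = 1)
    (he : inner ℂ e (gammaOp α (Fin.last n) e) = 0) (ξ η : EuclideanSpace ℝ (Fin n)) :
    ‖slash α e ξ + slash α (gammaOp α (Fin.last n) e) η‖ ^ 2 = ‖ξ‖ ^ 2 + ‖η‖ ^ 2 := by
  rw [norm_add_sq (𝕜 := ℂ), norm_slash hα, norm_slash hα, norm_gammaOp hα, hne]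
  have := re_inner_slash_slash hα he ξ η
  simp only [RCLike.re_to_complex, this]
  ring

/-- The witness is a multiple of `(1 + α₁) χ`: since `β` anticommutes with `α₁`,
`⟪(1 + α₁) χ, β (1 + α₁) χ⟫ = ⟪χ, β (1 - α₁) (1 + α₁) χ⟫ = 0`. -/
lemma exists_inner_gammaOp_last_eq_zero (hα : IsDiracMatrices n α) (hn : 0 < n) :
    ∃ e : Spinor n, ‖e‖ = 1 ∧ inner ℂ e (gammaOp α (Fin.last n) e) = 0 := by
  have hN : 0 < spinorDim n := by unfold spinorDim; positivity
  set β := gammaOp α (Fin.last n)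
  set A := gammaOp α (Fin.castSucc ⟨0, hn⟩)
  have hne : (Fin.castSucc (⟨0, hn⟩ : Fin n)) ≠ Fin.last n := (Fin.castSucc_lt_last _).ne
  have key : ∀ χ : Spinor n, inner ℂ (χ + A χ) (β (χ + A χ)) = 0 := by
    intro χ
    have h1 : A (β χ) = -β (A χ) := gammaOp_swap hα hne χ
    have h2 : A (β (A χ)) = -β χ := by rw [gammaOp_swap hα hne, gammaOp_sq hα]
    rw [inner_add_left, inner_gammaOp hα, ← inner_add_right, map_add, map_add]
    change inner ℂ χ (β χ + β (A χ) + (A (β χ) + A (β (A χ)))) = 0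
    rw [h1, h2]
    rw [← inner_zero_right (𝕜 := ℂ) χ]
    congr 1
    abel
  obtain ⟨v, hv, hv0⟩ : ∃ v : Spinor n, inner ℂ v (β v) = 0 ∧ v ≠ 0 := by
    set χ : Spinor n := EuclideanSpace.single ⟨0, hN⟩ 1
    have hχ : χ ≠ 0 := by
      intro h
      have := congrArg (fun w : Spinor n => ‖w‖) h
      simp [χ] at this
    by_cases h : χ + A χ = 0
    · refine ⟨β χ + A (β χ), key _, fun h' => hχ ?_⟩
      have h1 : A (β χ) = -β (A χ) := gammaOp_swap hα hne χ
      rw [h1, ← sub_eq_add_neg, ← map_sub] at h'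
      have h3 : χ - A χ = 0 := by
        rw [← gammaOp_sq hα (Fin.last n) (χ - A χ)]
        change β (β (χ - A χ)) = 0
        rw [h', map_zero]
      have : (2 : ℝ) • χ = 0 := by
        rw [two_smul]
        calc χ + χ = (χ + A χ) + (χ - A χ) := by abel
          _ = 0 := by rw [h, h3, add_zero]
      simpa using this
    · exact ⟨_, key χ, h⟩
  refine ⟨((‖v‖⁻¹ : ℝ) : ℂ) • v, ?_, ?_⟩
  · rw [norm_smul]
    simp [hv0]
  · rw [map_smul, inner_smul_left, inner_smul_right, hv]
    simp

end Clifford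

/-! ### The Dirac operator on Clifford multiples of vector fields -/

section Dirac

variable {n : ℕ} {α : Fin (n + 1) → Matrix (Fin (spinorDim n)) (Fin (spinorDim n)) ℂ}

lemma HasFDerivAt.diracOp {u : EuclideanSpace ℝ (Fin n) → Spinor n} {x : EuclideanSpace ℝ (Fin n)}
    {L : EuclideanSpace ℝ (Fin n) →L[ℝ] Spinor n} (h : HasFDerivAt u L x) :
    diracOp α u x =
      (-Complex.I) • ∑ j : Fin n, gammaOp α j.castSucc (L (EuclideanSpace.single j 1)) := by
  simp only [_root_.diracOp, partialDeriv, h.fderiv]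
  rfl

/-- `L` is the derivative at a point of a vector field that is divergence free and curl free. -/
structure IsSymmTraceless (L : EuclideanSpace ℝ (Fin n) →L[ℝ] EuclideanSpace ℝ (Fin n)) :
    Prop where
  symm : ∀ v w, inner ℝ (L v) w = inner ℝ v (L w)
  trace : ∑ j : Fin n, L (EuclideanSpace.single j 1) j = 0

/-- The symbol of `𝓓` applied to the derivative of `slash α v (φ F)`, where `c`, `g` are the value
and the derivative of `φ` and `F`, `L` those of a divergence free and curl free field: only the
derivative of `φ` contributes. -/
lemma sum_gammaOp_slash_smul (hα : IsDiracMatrices n α) (v : Spinor n) (c : ℝ)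
    {L : EuclideanSpace ℝ (Fin n) →L[ℝ] EuclideanSpace ℝ (Fin n)} (hL : IsSymmTraceless L)
    (g : EuclideanSpace ℝ (Fin n) →L[ℝ] ℝ) (F : EuclideanSpace ℝ (Fin n)) :
    ∑ j : Fin n, gammaOp α j.castSucc
        (slash α v ((c • L + g.smulRight F) (EuclideanSpace.single j 1))) =
      slash α (slash α v F) ((InnerProductSpace.toDual ℝ _).symm g) := by
  have h1 : ∑ j : Fin n, gammaOp α j.castSucc (slash α v (L (EuclideanSpace.single j 1))) = 0 := by
    rw [sum_gammaOp_slash hα v (b := fun j => L (EuclideanSpace.single j 1)), hL.trace, zero_smul]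
    intro j k
    have := hL.symm (EuclideanSpace.single j 1) (EuclideanSpace.single k 1)
    simpa [EuclideanSpace.inner_single_left, EuclideanSpace.inner_single_right] using this
  have h2 : ∀ j, ((InnerProductSpace.toDual ℝ (EuclideanSpace ℝ (Fin n))).symm g) j =
      g (EuclideanSpace.single j 1) := by
    intro j
    rw [← InnerProductSpace.toDual_symm_apply (𝕜 := ℝ), EuclideanSpace.inner_single_right]
    simp
  simp only [add_apply, smul_apply, map_add, map_smul,
    gammaOp_real_smul, Finset.sum_add_distrib, ← Finset.smul_sum, h1, smul_zero, zero_add,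
    ContinuousLinearMap.smulRight_apply, slash_apply (slash α v F), h2]

end Dirac

/-! ### Axially symmetric homogeneous fields -/

section AxialField

variable {n : ℕ}

/-- The coefficients `(P, Q)` of the axially symmetric, divergence free and curl free polynomial
vector field `P a - Q y` of degree `m` on `ℝⁿ`. Here `a` is a unit vector and
`x = ⟪a, x⟫ a + y` with `y ⟂ a`. -/
noncomputable def axialPair (a : EuclideanSpace ℝ (Fin n)) :
    ℕ → EuclideanSpace ℝ (Fin n) → ℝ × ℝ
  | 0, _ => (1, 0)
  | m + 1, x =>
    (inner ℝ a x * (axialPair a m x).1 - (‖x‖ ^ 2 - inner ℝ a x ^ 2) * (axialPair a m x).2,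
      (m + 1) / (m + n - 1) * ((axialPair a m x).1 + inner ℝ a x * (axialPair a m x).2))

/-- The divergence free and curl free axial vector field of degree `m`. It is a multiple of the
gradient of the solid zonal harmonic of degree `m + 1` with axis `a`. -/
noncomputable def axialField (a : EuclideanSpace ℝ (Fin n)) (m : ℕ)
    (x : EuclideanSpace ℝ (Fin n)) : EuclideanSpace ℝ (Fin n) :=
  (axialPair a m x).1 • a - (axialPair a m x).2 • (x - inner ℝ a x • a)

variable {a : EuclideanSpace ℝ (Fin n)}

lemma contDiff_axialPair (m : ℕ) : ContDiff ℝ ∞ (axialPair a m) := by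
  induction m with
  | zero => exact contDiff_const
  | succ m ih =>
    have h1 : ContDiff ℝ ∞ fun x => (axialPair a m x).1 := contDiff_fst.comp ih
    have h2 : ContDiff ℝ ∞ fun x => (axialPair a m x).2 := contDiff_snd.comp ih
    have hz : ContDiff ℝ ∞ fun x : EuclideanSpace ℝ (Fin n) => (inner ℝ a x : ℝ) :=
      contDiff_const.inner ℝ contDiff_id
    have hr : ContDiff ℝ ∞ fun x : EuclideanSpace ℝ (Fin n) => ‖x‖ ^ 2 := contDiff_norm_sq ℝ
    exact ((hz.mul h1).sub ((hr.sub (hz.pow 2)).mul h2)).prodMk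
      (contDiff_const.mul (h1.add (hz.mul h2)))

lemma contDiff_axialField (m : ℕ) : ContDiff ℝ ∞ (axialField a m) := by
  have h1 : ContDiff ℝ ∞ fun x => (axialPair a m x).1 := contDiff_fst.comp (contDiff_axialPair m)
  have h2 : ContDiff ℝ ∞ fun x => (axialPair a m x).2 := contDiff_snd.comp (contDiff_axialPair m)
  have hz : ContDiff ℝ ∞ fun x : EuclideanSpace ℝ (Fin n) => (inner ℝ a x : ℝ) :=
    contDiff_const.inner ℝ contDiff_id
  exact (h1.smul contDiff_const).sub (h2.smul (contDiff_id.sub (hz.smul contDiff_const)))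

lemma inner_sub_axis (ha : ‖a‖ = 1) (x : EuclideanSpace ℝ (Fin n)) :
    inner ℝ a (x - (inner ℝ a x : ℝ) • a) = (0 : ℝ) := by
  rw [inner_sub_right, inner_smul_right, real_inner_self_eq_norm_sq, ha]
  ring

lemma norm_sq_sub_axis (ha : ‖a‖ = 1) (x : EuclideanSpace ℝ (Fin n)) :
    ‖x - (inner ℝ a x : ℝ) • a‖ ^ 2 = ‖x‖ ^ 2 - (inner ℝ a x : ℝ) ^ 2 := by
  rw [norm_sub_sq_real, inner_smul_right, norm_smul, ha, real_inner_comm, Real.norm_eq_abs,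
    mul_one, sq_abs]
  ring

lemma norm_sq_axialField (ha : ‖a‖ = 1) (m : ℕ) (x : EuclideanSpace ℝ (Fin n)) :
    ‖axialField a m x‖ ^ 2 = (axialPair a m x).1 ^ 2 +
      (‖x‖ ^ 2 - (inner ℝ a x : ℝ) ^ 2) * (axialPair a m x).2 ^ 2 := by
  rw [axialField, norm_sub_sq_real, inner_smul_left, inner_smul_right, inner_sub_axis ha,
    norm_smul, norm_smul, mul_pow, mul_pow, norm_sq_sub_axis ha, ha, Real.norm_eq_abs,
    Real.norm_eq_abs, sq_abs, sq_abs]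
  ring

lemma inner_axis_sq_le (ha : ‖a‖ = 1) (x : EuclideanSpace ℝ (Fin n)) :
    (inner ℝ a x : ℝ) ^ 2 ≤ ‖x‖ ^ 2 := by
  have := norm_sq_sub_axis ha x
  nlinarith [sq_nonneg ‖x - (inner ℝ a x : ℝ) • a‖]

lemma abs_inner_axis_le (ha : ‖a‖ = 1) (x : EuclideanSpace ℝ (Fin n)) :
    |(inner ℝ a x : ℝ)| ≤ ‖x‖ := by
  simpa [ha] using abs_real_inner_le_norm a x

/-- The passage from `(P, Q)` to the next pair is, up to the factor `κ` on the second entry,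
a rotation followed by a dilation. -/
lemma axial_step_sq (z t p q κ : ℝ) :
    (z * p - t * q) ^ 2 + t * (κ * (p + z * q)) ^ 2 =
      (z ^ 2 + t) * (p ^ 2 + t * q ^ 2) - (1 - κ ^ 2) * (t * (p + z * q) ^ 2) := by
  ring

lemma norm_axialField_succ_le (hn : 2 ≤ n) (ha : ‖a‖ = 1) (m : ℕ)
    (x : EuclideanSpace ℝ (Fin n)) :
    ‖axialField a (m + 1) x‖ ≤ ‖x‖ * ‖axialField a m x‖ := by
  have hn' : (2 : ℝ) ≤ n := by exact_mod_cast hn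
  have ht : (0 : ℝ) ≤ ‖x‖ ^ 2 - (inner ℝ a x : ℝ) ^ 2 := sub_nonneg.2 (inner_axis_sq_le ha x)
  refine (sq_le_sq₀ (by positivity) (by positivity)).1 ?_
  rw [mul_pow, norm_sq_axialField ha, norm_sq_axialField ha, axialPair, axial_step_sq]
  set κ : ℝ := (m + 1) / (m + n - 1)
  have hm : (0 : ℝ) ≤ m := m.cast_nonneg
  have hκ0 : 0 ≤ κ := div_nonneg (by linarith) (by linarith)
  have hκ1 : κ ≤ 1 := (div_le_one (by linarith)).2 (by linarith)
  have : 0 ≤ (1 - κ ^ 2) * ((‖x‖ ^ 2 - (inner ℝ a x : ℝ) ^ 2) *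
      ((axialPair a m x).1 + inner ℝ a x * (axialPair a m x).2) ^ 2) :=
    mul_nonneg (by nlinarith) (by positivity)
  linarith

lemma le_norm_axialField_succ (hn : 2 ≤ n) (hn3 : n ≤ 3) (ha : ‖a‖ = 1) (m : ℕ)
    (x : EuclideanSpace ℝ (Fin n)) :
    (m + 1) / (m + 2) * (‖x‖ * ‖axialField a m x‖) ≤ ‖axialField a (m + 1) x‖ := by
  have hn' : (2 : ℝ) ≤ n := by exact_mod_cast hn
  have hn3' : (n : ℝ) ≤ 3 := by exact_mod_cast hn3
  have hm : (0 : ℝ) ≤ m := m.cast_nonneg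
  have ht : (0 : ℝ) ≤ ‖x‖ ^ 2 - (inner ℝ a x : ℝ) ^ 2 := sub_nonneg.2 (inner_axis_sq_le ha x)
  refine (sq_le_sq₀ (by positivity) (by positivity)).1 ?_
  rw [mul_pow, mul_pow, norm_sq_axialField ha, norm_sq_axialField ha, axialPair]
  set κ : ℝ := (m + 1) / (m + n - 1)
  have hκ : ((m : ℝ) + 1) / (m + 2) ≤ κ :=
    div_le_div_of_nonneg_left (by linarith) (by linarith) (by linarith)
  set μ : ℝ := ((m : ℝ) + 1) / (m + 2)
  have hμ0 : 0 ≤ μ := by positivity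
  have hμ1 : μ ≤ 1 := (div_le_one (by linarith)).2 (by linarith)
  set z : ℝ := inner ℝ a x
  set p := (axialPair a m x).1
  set q := (axialPair a m x).2
  have h1 : μ ^ 2 * (z * p - (‖x‖ ^ 2 - z ^ 2) * q) ^ 2 ≤
      (z * p - (‖x‖ ^ 2 - z ^ 2) * q) ^ 2 :=
    mul_le_of_le_one_left (sq_nonneg _) (by nlinarith)
  have h2 : (‖x‖ ^ 2 - z ^ 2) * (p + z * q) ^ 2 * μ ^ 2 ≤
      (‖x‖ ^ 2 - z ^ 2) * (p + z * q) ^ 2 * κ ^ 2 :=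
    mul_le_mul_of_nonneg_left (pow_le_pow_left₀ hμ0 hκ 2) (by positivity)
  have h3 := axial_step_sq z (‖x‖ ^ 2 - z ^ 2) p q 1
  simp only [one_pow, sub_self, zero_mul, sub_zero, one_mul] at h3
  have h4 : μ ^ 2 * (‖x‖ ^ 2 * (p ^ 2 + (‖x‖ ^ 2 - z ^ 2) * q ^ 2)) =
      μ ^ 2 * ((z * p - (‖x‖ ^ 2 - z ^ 2) * q) ^ 2 + (‖x‖ ^ 2 - z ^ 2) * (p + z * q) ^ 2) := by
    rw [h3]; ring
  simp only
  rw [h4, mul_pow κ]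
  linarith

lemma norm_axialField_add_le (hn : 2 ≤ n) (ha : ‖a‖ = 1) (m k : ℕ)
    (x : EuclideanSpace ℝ (Fin n)) :
    ‖axialField a (m + k) x‖ ≤ ‖x‖ ^ k * ‖axialField a m x‖ := by
  induction k with
  | zero => simp
  | succ k ih =>
    calc ‖axialField a (m + k + 1) x‖ ≤ ‖x‖ * ‖axialField a (m + k) x‖ :=
          norm_axialField_succ_le hn ha _ x
      _ ≤ ‖x‖ * (‖x‖ ^ k * ‖axialField a m x‖) := by gcongr
      _ = ‖x‖ ^ (k + 1) * ‖axialField a m x‖ := by ring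

/-- Raising the degree from `m` to `m + k` changes the angular profile of an axial field only by
a bounded factor as long as `k` is at most comparable to `m`. -/
lemma le_norm_axialField_add (hn : 2 ≤ n) (hn3 : n ≤ 3) (ha : ‖a‖ = 1) (m k : ℕ)
    (x : EuclideanSpace ℝ (Fin n)) :
    (m + 1) / (m + k + 1) * (‖x‖ ^ k * ‖axialField a m x‖) ≤ ‖axialField a (m + k) x‖ := by
  induction k with
  | zero =>
    have : (m : ℝ) + 1 ≠ 0 := by positivity
    simp [div_self this]
  | succ k ih =>
    have h := le_norm_axialField_succ hn hn3 ha (m + k) x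
    refine le_trans (le_of_eq ?_) ((mul_le_mul_of_nonneg_left
      (mul_le_mul_of_nonneg_left ih (norm_nonneg x)) (by positivity)).trans h)
    push_cast
    field_simp
    ring

lemma norm_axialField_zero (ha : ‖a‖ = 1) (x : EuclideanSpace ℝ (Fin n)) :
    ‖axialField a 0 x‖ = 1 := by
  simp [axialField, axialPair, ha]

lemma norm_axialField_le (hn : 2 ≤ n) (ha : ‖a‖ = 1) (m : ℕ) (x : EuclideanSpace ℝ (Fin n)) :
    ‖axialField a m x‖ ≤ ‖x‖ ^ m := by
  simpa [norm_axialField_zero ha] using norm_axialField_add_le hn ha 0 m x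

lemma abs_axialPair_fst_le (hn : 2 ≤ n) (ha : ‖a‖ = 1) (m : ℕ)
    (x : EuclideanSpace ℝ (Fin n)) : |(axialPair a m x).1| ≤ ‖x‖ ^ m := by
  refine le_trans ?_ (norm_axialField_le hn ha m x)
  refine abs_le_of_sq_le_sq ?_ (norm_nonneg _)
  rw [norm_sq_axialField ha]
  have ht : (0 : ℝ) ≤ ‖x‖ ^ 2 - (inner ℝ a x : ℝ) ^ 2 := sub_nonneg.2 (inner_axis_sq_le ha x)
  have := mul_nonneg ht (sq_nonneg (axialPair a m x).2)
  linarith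

lemma norm_mul_abs_axialPair_snd_le (hn : 2 ≤ n) (ha : ‖a‖ = 1) (m : ℕ)
    (x : EuclideanSpace ℝ (Fin n)) : ‖x‖ * |(axialPair a m x).2| ≤ m * ‖x‖ ^ m := by
  have hn' : (2 : ℝ) ≤ n := by exact_mod_cast hn
  induction m with
  | zero => simp [axialPair]
  | succ m ih =>
    have hm : (0 : ℝ) ≤ m := m.cast_nonneg
    rw [axialPair]
    set κ : ℝ := (m + 1) / (m + n - 1)
    have hκ0 : 0 ≤ κ := div_nonneg (by linarith) (by linarith)
    have hκ1 : κ ≤ 1 := (div_le_one (by linarith)).2 (by linarith)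
    set p := (axialPair a m x).1
    set q := (axialPair a m x).2
    have hp : |p| ≤ ‖x‖ ^ m := abs_axialPair_fst_le hn ha m x
    have hz := abs_inner_axis_le ha x
    calc ‖x‖ * |κ * (p + inner ℝ a x * q)| = κ * (‖x‖ * |p + inner ℝ a x * q|) := by
          rw [abs_mul, abs_of_nonneg hκ0]; ring
      _ ≤ 1 * (‖x‖ * (|p| + |(inner ℝ a x : ℝ)| * |q|)) := by
          gcongr
          exact (abs_add_le _ _).trans_eq (by rw [abs_mul])
      _ ≤ ‖x‖ * (‖x‖ ^ m + ‖x‖ * |q|) := by rw [one_mul]; gcongr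
      _ ≤ ‖x‖ * (‖x‖ ^ m + m * ‖x‖ ^ m) := by gcongr
      _ = (m + 1 : ℕ) * ‖x‖ ^ (m + 1) := by push_cast; ring

/-- The gradients of the coefficients `P` and `Q` lie in the plane of `a` and `y`. The two
gradients share the coefficient `B` (the field is curl free); the three linear relations express
that the divergence vanishes and that `P` and `Q` are homogeneous. -/
lemma exists_hasFDerivAt_axialPair (hn : 2 ≤ n) (ha : ‖a‖ = 1) (m : ℕ)
    (x : EuclideanSpace ℝ (Fin n)) :
    ∃ A B C : ℝ,
      HasFDerivAt (fun x => (axialPair a m x).1)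
        (innerSL ℝ (A • a + B • (x - (inner ℝ a x : ℝ) • a))) x ∧
      HasFDerivAt (fun x => (axialPair a m x).2)
        (innerSL ℝ (-B • a + C • (x - (inner ℝ a x : ℝ) • a))) x ∧
      A = (n - 1) * (axialPair a m x).2 + (‖x‖ ^ 2 - inner ℝ a x ^ 2) * C ∧
      inner ℝ a x * A + (‖x‖ ^ 2 - inner ℝ a x ^ 2) * B = m * (axialPair a m x).1 ∧
      -inner ℝ a x * B + (‖x‖ ^ 2 - inner ℝ a x ^ 2) * C = (m - 1) * (axialPair a m x).2 ∧
      ‖x‖ * |A| ≤ m * ‖x‖ ^ m ∧ ‖x‖ ^ 2 * |B| ≤ m ^ 2 * ‖x‖ ^ m := by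
  have hn' : (2 : ℝ) ≤ n := by exact_mod_cast hn
  induction m with
  | zero =>
    refine ⟨0, 0, 0, ?_, ?_, ?_⟩
    · simpa [axialPair] using hasFDerivAt_const (1 : ℝ) x
    · simpa [axialPair] using hasFDerivAt_const (0 : ℝ) x
    · simp [axialPair]
  | succ m ih =>
    obtain ⟨A, B, C, hP, hQ, e1, e2, e3, -, -⟩ := ih
    have hm : (0 : ℝ) ≤ m := m.cast_nonneg
    have hz : HasFDerivAt (fun x => (inner ℝ a x : ℝ)) (innerSL ℝ a) x :=
      (innerSL ℝ a).hasFDerivAt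
    have hr := (hasStrictFDerivAt_norm_sq x).hasFDerivAt
    have ht := hr.sub (hz.pow 2)
    have bp := abs_axialPair_fst_le hn ha m x
    have bq := norm_mul_abs_axialPair_snd_le hn ha m x
    have hD : (m : ℝ) + n - 1 ≠ 0 := by linarith
    simp only [axialPair]
    set z : ℝ := inner ℝ a x with hzdef
    set t : ℝ := ‖x‖ ^ 2 - z ^ 2 with htdef
    set p := (axialPair a m x).1
    set q := (axialPair a m x).2
    set κ : ℝ := (m + 1) / (m + n - 1) with hκ
    have hκD : κ * (m + n - 1) = m + 1 := div_mul_cancel₀ _ hD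
    refine ⟨(m + 1) * p, -((m + 1) * q), κ * (B + z * C), ?_, ?_, ?_, ?_, ?_, ?_, ?_⟩
    · refine ((hz.mul hP).sub (ht.mul hQ)).congr_fderiv ?_
      ext v
      simp [← hzdef]
      linear_combination (inner ℝ a v : ℝ) * e2 -
        ((inner ℝ x v : ℝ) - z * inner ℝ a v) * e3
    · refine ((hP.add (hz.mul hQ)).const_mul κ).congr_fderiv ?_
      ext v
      simp [← hzdef]
      linear_combination (inner ℝ a v : ℝ) * (κ * e1 + κ * e3 + q * hκD)
    · linear_combination (-p) * hκD + κ * z * e1 - κ * e2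
    · push_cast
      ring
    · push_cast
      linear_combination (-q) * z * hκD + κ * e2 - κ * z * e1
    · rw [abs_mul, abs_of_nonneg (by linarith : (0 : ℝ) ≤ m + 1)]
      calc ‖x‖ * ((m + 1) * |p|) ≤ ‖x‖ * ((m + 1) * ‖x‖ ^ m) := by gcongr
        _ = _ := by push_cast; ring
    · rw [abs_neg, abs_mul, abs_of_nonneg (by linarith : (0 : ℝ) ≤ m + 1)]
      calc ‖x‖ ^ 2 * ((m + 1) * |q|) = ‖x‖ * (m + 1) * (‖x‖ * |q|) := by ring
        _ ≤ ‖x‖ * (m + 1) * (m * ‖x‖ ^ m) := by gcongr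
        _ ≤ ‖x‖ * (m + 1) * ((m + 1) * ‖x‖ ^ m) := by gcongr; linarith
        _ = _ := by push_cast; ring

/-- An axial field of degree `m` is divergence free and curl free, and its derivative costs only a
factor quadratic in `m`. -/
lemma exists_hasFDerivAt_axialField (hn : 2 ≤ n) (ha : ‖a‖ = 1) (m : ℕ)
    (x : EuclideanSpace ℝ (Fin n)) :
    ∃ L, HasFDerivAt (axialField a m) L x ∧ IsSymmTraceless L ∧
      ‖x‖ * ‖L‖ ≤ 8 * (m + 1) ^ 2 * ‖x‖ ^ m := by
  obtain ⟨A, B, C, hP, hQ, e1, -, e3, bA, bB⟩ := exists_hasFDerivAt_axialPair hn ha m x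
  have bQ := norm_mul_abs_axialPair_snd_le hn ha m x
  have hz : HasFDerivAt (fun x => (inner ℝ a x : ℝ)) (innerSL ℝ a) x :=
    (innerSL ℝ a).hasFDerivAt
  have hy := (hasFDerivAt_id x).sub (hz.smul_const a)
  have hF := (hP.smul_const a).sub (hQ.smul hy)
  have hay := inner_sub_axis ha x
  have hyy := norm_sq_sub_axis ha x
  have hya : ‖x - (inner ℝ a x : ℝ) • a‖ ≤ ‖x‖ := by
    refine (sq_le_sq₀ (norm_nonneg _) (norm_nonneg _)).1 ?_
    rw [hyy]
    linarith [sq_nonneg (inner ℝ a x : ℝ)]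
  rw [← hyy] at e1 e3
  set y := x - (inner ℝ a x : ℝ) • a with hydef
  set q := (axialPair a m x).2
  have hm : (0 : ℝ) ≤ m := m.cast_nonneg
  obtain ⟨L, hLdef⟩ : ∃ L : EuclideanSpace ℝ (Fin n) →L[ℝ] EuclideanSpace ℝ (Fin n), L =
    (innerSL ℝ (A • a + B • y)).smulRight a - (q • (ContinuousLinearMap.id ℝ _ -
      (innerSL ℝ a).smulRight a) + (innerSL ℝ (-B • a + C • y)).smulRight y) := ⟨_, rfl⟩
  have hL : ∀ v, L v = (A * inner ℝ a v + B * inner ℝ y v) • a +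
      (B * inner ℝ a v - C * inner ℝ y v) • y - q • (v - (inner ℝ a v : ℝ) • a) := by
    intro v
    rw [hLdef]
    simp only [sub_apply, add_apply, smul_apply, ContinuousLinearMap.smulRight_apply,
      innerSL_apply_apply, inner_add_left, real_inner_smul_left, ContinuousLinearMap.id_apply]
    module
  refine ⟨L, hLdef ▸ hF, ⟨fun v w => ?_, ?_⟩, ?_⟩
  · simp only [hL, inner_add_left, inner_sub_left, real_inner_smul_left, inner_add_right,
      inner_sub_right, real_inner_smul_right, real_inner_comm a v, real_inner_comm y v]
    ring
  · have hsum : ∀ v w : EuclideanSpace ℝ (Fin n), ∑ j, v j * w j = inner ℝ v w := fun v w => by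
      simp [PiLp.inner_apply, mul_comm]
    have h1 : ∀ j : Fin n, L (EuclideanSpace.single j 1) j =
        A * (a j * a j) + B * (y j * a j) + (B * (a j * y j) - C * (y j * y j)) -
          (q - q * (a j * a j)) := by
      intro j
      rw [hL]
      simp [EuclideanSpace.inner_single_right]
      ring
    simp only [h1, Finset.sum_add_distrib, Finset.sum_sub_distrib, ← Finset.mul_sum, hsum,
      real_inner_self_eq_norm_sq, ha, hay, real_inner_comm a y, Finset.sum_const,
      Finset.card_univ, Fintype.card_fin, nsmul_eq_mul]
    linear_combination e1
  · have hCt : ‖x‖ * (‖y‖ ^ 2 * |C|) ≤ (m + 1) * (‖x‖ * |q|) + ‖x‖ ^ 2 * |B| := by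
      have h2 : ‖y‖ ^ 2 * |C| ≤ (m + 1) * |q| + ‖x‖ * |B| := by
        calc ‖y‖ ^ 2 * |C| = |(m - 1) * q + inner ℝ a x * B| := by
              rw [show ‖y‖ ^ 2 * |C| = |‖y‖ ^ 2 * C| by rw [abs_mul, abs_of_nonneg (sq_nonneg ‖y‖)]]
              congr 1
              linear_combination e3
          _ ≤ |(m : ℝ) - 1| * |q| + |(inner ℝ a x : ℝ)| * |B| :=
              (abs_add_le _ _).trans_eq (by rw [abs_mul, abs_mul])
          _ ≤ _ := by
              gcongr
              · exact abs_le.2 ⟨by linarith, by linarith⟩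
              · exact abs_inner_axis_le ha x
      calc ‖x‖ * (‖y‖ ^ 2 * |C|) ≤ ‖x‖ * ((m + 1) * |q| + ‖x‖ * |B|) := by gcongr
        _ = _ := by ring
    have hLn : ‖L‖ ≤ |A| + |B| * ‖y‖ + (|B| * ‖y‖ + ‖y‖ ^ 2 * |C|) + |q| * 2 := by
      refine L.opNorm_le_bound (by positivity) fun v => ?_
      have hav : |(inner ℝ a v : ℝ)| ≤ ‖v‖ := abs_inner_axis_le ha v
      have hyv : |(inner ℝ y v : ℝ)| ≤ ‖y‖ * ‖v‖ := abs_real_inner_le_norm y v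
      rw [hL]
      have n1 : ‖(A * inner ℝ a v + B * inner ℝ y v) • a‖ ≤ (|A| + |B| * ‖y‖) * ‖v‖ := by
        rw [norm_smul, ha, mul_one, Real.norm_eq_abs]
        calc _ ≤ |A| * |(inner ℝ a v : ℝ)| + |B| * |(inner ℝ y v : ℝ)| :=
              (abs_add_le _ _).trans_eq (by rw [abs_mul, abs_mul])
          _ ≤ |A| * ‖v‖ + |B| * (‖y‖ * ‖v‖) := by gcongr
          _ = _ := by ring
      have n2 : ‖(B * inner ℝ a v - C * inner ℝ y v) • y‖ ≤
          (|B| * ‖y‖ + ‖y‖ ^ 2 * |C|) * ‖v‖ := by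
        rw [norm_smul, Real.norm_eq_abs]
        calc _ ≤ (|B| * |(inner ℝ a v : ℝ)| + |C| * |(inner ℝ y v : ℝ)|) * ‖y‖ := by
              gcongr
              exact (abs_sub _ _).trans_eq (by rw [abs_mul, abs_mul])
          _ ≤ (|B| * ‖v‖ + |C| * (‖y‖ * ‖v‖)) * ‖y‖ := by gcongr
          _ = _ := by ring
      have n3 : ‖q • (v - (inner ℝ a v : ℝ) • a)‖ ≤ |q| * 2 * ‖v‖ := by
        rw [norm_smul, Real.norm_eq_abs, mul_assoc]
        gcongr
        refine (norm_sub_le _ _).trans ?_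
        rw [norm_smul, ha, mul_one, Real.norm_eq_abs]
        linarith
      refine ((norm_sub_le _ _).trans (add_le_add ((norm_add_le _ _).trans
        (add_le_add n1 n2)) n3)).trans_eq ?_
      ring
    have hxB : ‖x‖ * (|B| * ‖y‖) ≤ ‖x‖ ^ 2 * |B| := by
      calc ‖x‖ * (|B| * ‖y‖) ≤ ‖x‖ * (|B| * ‖x‖) := by gcongr
        _ = _ := by ring
    have hr : 0 ≤ ‖x‖ ^ m := by positivity
    calc ‖x‖ * ‖L‖
        ≤ ‖x‖ * (|A| + |B| * ‖y‖ + (|B| * ‖y‖ + ‖y‖ ^ 2 * |C|) + |q| * 2) := by gcongr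
      _ = ‖x‖ * |A| + 2 * (‖x‖ * (|B| * ‖y‖)) + ‖x‖ * (‖y‖ ^ 2 * |C|) + 2 * (‖x‖ * |q|) := by ring
      _ ≤ m * ‖x‖ ^ m + 2 * (m ^ 2 * ‖x‖ ^ m) +
          ((m + 1) * (m * ‖x‖ ^ m) + m ^ 2 * ‖x‖ ^ m) + 2 * (m * ‖x‖ ^ m) := by
          have hC := hCt.trans (add_le_add
            (mul_le_mul_of_nonneg_left bQ (by linarith : (0 : ℝ) ≤ m + 1)) bB)
          linarith [hxB.trans bB]
      _ = (4 * m ^ 2 + 4 * m) * ‖x‖ ^ m := by ring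
      _ ≤ 8 * (m + 1) ^ 2 * ‖x‖ ^ m := by
          gcongr
          nlinarith

end AxialField

/-! ### A field decaying at infinity -/

section DipoleField

variable {n : ℕ}

/-- The divergence free and curl free field `∇(⟪a, x⟫ / |x|ⁿ)`, defined away from the origin and
decaying like `|x|⁻ⁿ`. -/
noncomputable def dipoleField (a x : EuclideanSpace ℝ (Fin n)) : EuclideanSpace ℝ (Fin n) :=
  (‖x‖ ^ (n + 2))⁻¹ • (‖x‖ ^ 2 • a - (n * inner ℝ a x : ℝ) • x)

variable {a : EuclideanSpace ℝ (Fin n)}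

lemma contDiffAt_dipoleField {x : EuclideanSpace ℝ (Fin n)} (hx : x ≠ 0) :
    ContDiffAt ℝ ∞ (dipoleField a) x := by
  have hz : ContDiffAt ℝ ∞ (fun x : EuclideanSpace ℝ (Fin n) => (inner ℝ a x : ℝ)) x :=
    contDiffAt_const.inner ℝ contDiffAt_id
  have hr : ContDiffAt ℝ ∞ (fun x : EuclideanSpace ℝ (Fin n) => ‖x‖) x := contDiffAt_norm ℝ hx
  exact (((hr.pow _).inv (pow_ne_zero _ (norm_ne_zero_iff.2 hx)))).smul
    (((hr.pow 2).smul contDiffAt_const).sub ((contDiffAt_const.mul hz).smul contDiffAt_id))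

lemma norm_sq_dipoleField (ha : ‖a‖ = 1) {x : EuclideanSpace ℝ (Fin n)} (hx : x ≠ 0) :
    ‖dipoleField a x‖ ^ 2 = ((‖x‖ ^ n)⁻¹) ^ 2 *
      (1 + n * (n - 2) * (inner ℝ a x : ℝ) ^ 2 / ‖x‖ ^ 2) := by
  have hx' : ‖x‖ ≠ 0 := norm_ne_zero_iff.2 hx
  rw [dipoleField, norm_smul, mul_pow, norm_sub_sq_real, norm_smul, norm_smul,
    real_inner_smul_left, real_inner_smul_right, ha, mul_pow, mul_pow, Real.norm_eq_abs,
    Real.norm_eq_abs, Real.norm_eq_abs, sq_abs, sq_abs, sq_abs]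
  field_simp
  ring

lemma le_norm_dipoleField (hn : 2 ≤ n) (ha : ‖a‖ = 1) {x : EuclideanSpace ℝ (Fin n)}
    (hx : x ≠ 0) : (‖x‖ ^ n)⁻¹ ≤ ‖dipoleField a x‖ := by
  have hn' : (2 : ℝ) ≤ n := by exact_mod_cast hn
  refine (sq_le_sq₀ (by positivity) (by positivity)).1 ?_
  rw [norm_sq_dipoleField ha hx]
  refine le_mul_of_one_le_right (by positivity) (le_add_of_nonneg_right ?_)
  have := sub_nonneg.2 hn'
  positivity

lemma norm_dipoleField_le (hn : 2 ≤ n) (ha : ‖a‖ = 1) {x : EuclideanSpace ℝ (Fin n)}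
    (hx : x ≠ 0) : ‖dipoleField a x‖ ≤ n * (‖x‖ ^ n)⁻¹ := by
  have hn' : (2 : ℝ) ≤ n := by exact_mod_cast hn
  refine (sq_le_sq₀ (by positivity) (by positivity)).1 ?_
  rw [norm_sq_dipoleField ha hx, mul_comm, mul_pow]
  gcongr
  have h1 : (inner ℝ a x : ℝ) ^ 2 / ‖x‖ ^ 2 ≤ 1 :=
    div_le_one_of_le₀ (inner_axis_sq_le ha x) (by positivity)
  have h2 : 0 ≤ (n : ℝ) * (n - 2) := mul_nonneg (by linarith) (by linarith)
  rw [mul_div_assoc]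
  nlinarith

lemma exists_hasFDerivAt_dipoleField (ha : ‖a‖ = 1) {x : EuclideanSpace ℝ (Fin n)}
    (hx : x ≠ 0) :
    ∃ L, HasFDerivAt (dipoleField a) L x ∧ IsSymmTraceless L ∧
      ‖x‖ ^ (n + 1) * ‖L‖ ≤ n ^ 2 + 5 * n := by
  have hx' : ‖x‖ ≠ 0 := norm_ne_zero_iff.2 hx
  have hx0 : 0 < ‖x‖ := norm_pos_iff.2 hx
  have hz : HasFDerivAt (fun x => (inner ℝ a x : ℝ)) (innerSL ℝ a) x :=
    (innerSL ℝ a).hasFDerivAt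
  have hsq := (hasStrictFDerivAt_norm_sq x).hasFDerivAt
  have hr : HasFDerivAt (fun x : EuclideanSpace ℝ (Fin n) => ‖x‖) (‖x‖⁻¹ • innerSL ℝ x) x := by
    have h := hsq.sqrt (by positivity)
    simp only [Real.sqrt_sq (norm_nonneg _)] at h
    refine h.congr_fderiv ?_
    ext v
    simp
    field_simp
  set z : ℝ := inner ℝ a x with hzdef
  set g : ℝ := (‖x‖ ^ (n + 2))⁻¹ with hgdef
  have hg : HasFDerivAt (fun x : EuclideanSpace ℝ (Fin n) => (‖x‖ ^ (n + 2))⁻¹)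
      ((-(n + 2) * g / ‖x‖ ^ 2) • innerSL ℝ x) x := by
    have h := (((hasDerivAt_pow (n + 2) ‖x‖).inv (pow_ne_zero _ hx'))).comp_hasFDerivAt x hr
    refine h.congr_fderiv ?_
    ext v
    simp [hgdef]
    field_simp
    ring
  have hF := hg.smul ((hsq.smul_const a).sub ((hz.const_mul (n : ℝ)).smul (hasFDerivAt_id x)))
  obtain ⟨L, hLdef⟩ : ∃ L : EuclideanSpace ℝ (Fin n) →L[ℝ] EuclideanSpace ℝ (Fin n), L =
    g • (((-(n : ℝ)) • innerSL ℝ x).smulRight a - ((n : ℝ) • innerSL ℝ a).smulRight x +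
      ((n * (n + 2) * z / ‖x‖ ^ 2) • innerSL ℝ x).smulRight x -
      (n * z) • ContinuousLinearMap.id ℝ _) := ⟨_, rfl⟩
  have hL : ∀ v, L v = g • ((-n * inner ℝ x v : ℝ) • a - (n * inner ℝ a v : ℝ) • x +
      (n * (n + 2) * z / ‖x‖ ^ 2 * inner ℝ x v) • x - (n * z) • v) := by
    intro v
    rw [hLdef]
    rfl
  refine ⟨L, hF.congr_fderiv ?_, ⟨fun v w => ?_, ?_⟩, ?_⟩
  · ext1 v
    rw [hL]
    simp only [add_apply, sub_apply, smul_apply, ContinuousLinearMap.smulRight_apply,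
      innerSL_apply_apply, ContinuousLinearMap.id_apply, Pi.sub_apply, Pi.smul_apply', id,
      ← hzdef, ← hgdef, smul_eq_mul, nsmul_eq_mul]
    match_scalars <;> field_simp
    ring
  · simp only [hL, inner_add_left, inner_sub_left, real_inner_smul_left, inner_add_right,
      inner_sub_right, real_inner_smul_right, real_inner_comm a v, real_inner_comm x v]
    ring
  · have hsum : ∀ v w : EuclideanSpace ℝ (Fin n), ∑ j, v j * w j = inner ℝ v w := fun v w => by
      simp [PiLp.inner_apply, mul_comm]
    have h1 : ∀ j : Fin n, L (EuclideanSpace.single j 1) j =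
        g * (-2 * n * (a j * x j) + n * (n + 2) * z / ‖x‖ ^ 2 * (x j * x j) - n * z) := by
      intro j
      rw [hL]
      simp [EuclideanSpace.inner_single_right, -mul_eq_mul_left_iff]
      ring
    simp only [h1, Finset.sum_add_distrib, Finset.sum_sub_distrib, ← Finset.mul_sum, hsum,
      real_inner_self_eq_norm_sq, Finset.sum_const, ← hzdef,
      Finset.card_univ, Fintype.card_fin, nsmul_eq_mul]
    field_simp
    ring
  · have hLn : ‖L‖ ≤ g * ((n ^ 2 + 5 * n) * ‖x‖) := by
      refine L.opNorm_le_bound (by positivity) fun v => ?_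
      have hxv : |(inner ℝ x v : ℝ)| ≤ ‖x‖ * ‖v‖ := abs_real_inner_le_norm x v
      have hav : |(inner ℝ a v : ℝ)| ≤ ‖v‖ := abs_inner_axis_le ha v
      have hza : |z| ≤ ‖x‖ := abs_inner_axis_le ha x
      rw [hL, norm_smul, Real.norm_of_nonneg (by positivity : 0 ≤ g), mul_assoc g]
      gcongr
      have n1 : ‖(-n * inner ℝ x v : ℝ) • a‖ ≤ n * (‖x‖ * ‖v‖) := by
        rw [norm_smul, ha, mul_one, Real.norm_eq_abs, abs_mul, abs_neg, Nat.abs_cast]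
        gcongr
      have n2 : ‖(n * inner ℝ a v : ℝ) • x‖ ≤ n * (‖x‖ * ‖v‖) := by
        rw [norm_smul, Real.norm_eq_abs, abs_mul, Nat.abs_cast, mul_assoc, mul_comm ‖x‖]
        gcongr
      have n3 : ‖(n * (n + 2) * z / ‖x‖ ^ 2 * inner ℝ x v) • x‖ ≤
          n * (n + 2) * (‖x‖ * ‖v‖) := by
        rw [norm_smul, Real.norm_eq_abs, abs_mul, abs_div, abs_mul, abs_pow, abs_norm,
          abs_of_nonneg (by positivity : (0 : ℝ) ≤ n * (n + 2))]
        calc _ ≤ n * (n + 2) * ‖x‖ / ‖x‖ ^ 2 * (‖x‖ * ‖v‖) * ‖x‖ := by gcongr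
          _ = _ := by field_simp
      have n4 : ‖(n * z) • v‖ ≤ n * (‖x‖ * ‖v‖) := by
        rw [norm_smul, Real.norm_eq_abs, abs_mul, Nat.abs_cast, mul_assoc]
        gcongr
      refine ((norm_sub_le _ _).trans (add_le_add ((norm_add_le _ _).trans
        (add_le_add ((norm_sub_le _ _).trans (add_le_add n1 n2)) n3)) n4)).trans_eq ?_
      ring
    calc ‖x‖ ^ (n + 1) * ‖L‖ ≤ ‖x‖ ^ (n + 1) * (g * ((n ^ 2 + 5 * n) * ‖x‖)) := by gcongr
      _ = n ^ 2 + 5 * n := by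
        rw [hgdef]
        field_simp
        ring

end DipoleField

/-! ### The partition of unity -/

section Weights

/-- The partition of unity `∑ₖ weight k s = 1` of the half-line `0 < s`; the `k`-th weight lives on
`[k, k + 2]`, except that the weight of index `0` equals `1` also for `s ≤ 1`. -/
noncomputable def weight (k : ℕ) (s : ℝ) : ℝ :=
  (if k = 0 then 1 else Real.smoothTransition (s - k)) - Real.smoothTransition (s - k - 1)

lemma contDiff_weight (k : ℕ) : ContDiff ℝ ∞ (weight k) := by
  have h : ∀ c : ℝ, ContDiff ℝ ∞ fun s : ℝ => Real.smoothTransition (s - c) := fun c =>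
    Real.smoothTransition.contDiff.comp (contDiff_id.sub contDiff_const)
  have h2 : ContDiff ℝ ∞ fun s : ℝ => Real.smoothTransition (s - k - 1) := by
    simpa only [sub_sub] using h (k + 1)
  unfold weight
  split_ifs
  · exact contDiff_const.sub h2
  · exact (h k).sub h2

lemma weight_nonneg (k : ℕ) (s : ℝ) : 0 ≤ weight k s := by
  unfold weight
  split_ifs
  · exact sub_nonneg.2 (Real.smoothTransition.le_one _)
  · exact sub_nonneg.2 (Real.smoothTransition.monotone (by linarith))

lemma weight_le_one (k : ℕ) (s : ℝ) : weight k s ≤ 1 := by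
  unfold weight
  have := Real.smoothTransition.nonneg (s - k - 1)
  split_ifs
  · linarith
  · linarith [Real.smoothTransition.le_one (s - k)]

lemma weight_eq_zero_of_le {k : ℕ} (hk : k ≠ 0) {s : ℝ} (hs : s ≤ k) : weight k s = 0 := by
  rw [weight, if_neg hk, Real.smoothTransition.zero_of_nonpos (by linarith),
    Real.smoothTransition.zero_of_nonpos (by linarith), sub_zero]

lemma weight_eq_zero_of_ge {k : ℕ} {s : ℝ} (hs : k + 2 ≤ s) : weight k s = 0 := by
  rw [weight, Real.smoothTransition.one_of_one_le (by linarith : 1 ≤ s - k - 1),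
    Real.smoothTransition.one_of_one_le (by linarith : 1 ≤ s - k), ite_self, sub_self]

lemma weight_zero_of_le_one {s : ℝ} (hs : s ≤ 1) : weight 0 s = 1 := by
  rw [weight, if_pos rfl, Real.smoothTransition.zero_of_nonpos (by simpa using hs), sub_zero]

lemma weight_add_weight_succ {k : ℕ} {s : ℝ} (h1 : k + 1 ≤ s) (h2 : s ≤ k + 2) :
    weight k s + weight (k + 1) s = 1 := by
  rw [weight, weight, if_neg k.succ_ne_zero]
  push_cast
  rw [Real.smoothTransition.one_of_one_le (by linarith : 1 ≤ s - k), ite_self,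
    Real.smoothTransition.zero_of_nonpos (by linarith : s - (k + 1) - 1 ≤ 0), sub_sub s]
  ring

lemma deriv_weight_eq_zero {k : ℕ} {s : ℝ} (h : weight k s = 0) : deriv (weight k) s = 0 :=
  IsLocalMin.deriv_eq_zero (Filter.Eventually.of_forall fun t => h ▸ weight_nonneg k t)

lemma deriv_weight_zero_of_le_one {s : ℝ} (hs : s ≤ 1) : deriv (weight 0) s = 0 :=
  IsLocalMax.deriv_eq_zero
    (Filter.Eventually.of_forall fun t => (weight_zero_of_le_one hs) ▸ weight_le_one 0 t)

lemma exists_abs_deriv_weight_le : ∃ M : ℝ, 0 < M ∧ ∀ k s, |deriv (weight k) s| ≤ M := by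
  have hc : Continuous (deriv Real.smoothTransition) :=
    (Real.smoothTransition.contDiff (n := 1)).continuous_deriv le_rfl
  obtain ⟨B, hB⟩ := (isCompact_Icc (a := (0 : ℝ)) (b := 1)).exists_bound_of_continuousOn
    hc.continuousOn
  have hB0 : 0 ≤ B := (norm_nonneg _).trans (hB 0 (by simp))
  have hθ : ∀ s, |deriv Real.smoothTransition s| ≤ B := by
    intro s
    rcases le_total s 0 with h | h
    · have : deriv Real.smoothTransition s = 0 := IsLocalMin.deriv_eq_zero
        (Filter.Eventually.of_forall fun t =>
          (Real.smoothTransition.zero_of_nonpos h).symm ▸ Real.smoothTransition.nonneg t)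
      simpa [this] using hB0
    rcases le_total s 1 with h' | h'
    · exact hB s ⟨h, h'⟩
    · have : deriv Real.smoothTransition s = 0 := IsLocalMax.deriv_eq_zero
        (Filter.Eventually.of_forall fun t =>
          (Real.smoothTransition.one_of_one_le h').symm ▸ Real.smoothTransition.le_one t)
      simpa [this] using hB0
  have hd : ∀ c s : ℝ, HasDerivAt (fun s : ℝ => Real.smoothTransition (s - c))
      (deriv Real.smoothTransition (s - c)) s := fun c s => by
    have h : HasDerivAt Real.smoothTransition (deriv Real.smoothTransition (s - c)) (s - c) :=
      ((Real.smoothTransition.contDiff (n := 1)).differentiable (by simp) _).hasDerivAt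
    simpa using h.comp_sub_const s c
  refine ⟨B + B + 1, by linarith, fun k s => ?_⟩
  by_cases hk : k = 0
  · have h : HasDerivAt (weight k) (0 - deriv Real.smoothTransition (s - (k + 1))) s := by
      refine ((hasDerivAt_const s (1 : ℝ)).sub (hd (k + 1) s)).congr_of_eventuallyEq
        (Filter.Eventually.of_forall fun t => ?_)
      simp [weight, hk]
    rw [h.deriv, zero_sub, abs_neg]
    linarith [hθ (s - (k + 1))]
  · have h : HasDerivAt (weight k) (deriv Real.smoothTransition (s - k) -
        deriv Real.smoothTransition (s - (k + 1))) s := by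
      refine ((hd k s).sub (hd (k + 1) s)).congr_of_eventuallyEq
        (Filter.Eventually.of_forall fun t => ?_)
      simp [weight, hk, sub_sub]
    rw [h.deriv]
    linarith [abs_sub (deriv Real.smoothTransition (s - k))
      (deriv Real.smoothTransition (s - (k + 1))), hθ (s - (k + 1)), hθ (s - k)]

end Weights

/-! ### The stage function and the transition radii -/

section Stage

variable {n : ℕ}

/-- The function `(e |x|) ^ (1 - γ)`; stage `k` hands over to stage `k + 1` where its value runs
through `[k + 1, k + 2]`. The factor `e` puts all transitions inside `|x| ≤ 1 / e`. At the
origin the value is the junk `exp (1 - γ) < 1`. -/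
noncomputable def stage (γ : ℝ) (x : EuclideanSpace ℝ (Fin n)) : ℝ :=
  Real.exp (-(γ - 1) * (1 + Real.log ‖x‖))

lemma stage_pos (γ : ℝ) (x : EuclideanSpace ℝ (Fin n)) : 0 < stage γ x := Real.exp_pos _

lemma contDiffAt_stage (γ : ℝ) {x : EuclideanSpace ℝ (Fin n)} (hx : x ≠ 0) :
    ContDiffAt ℝ ∞ (stage γ) x :=
  (contDiffAt_const.mul (contDiffAt_const.add
    ((contDiffAt_norm ℝ hx).log (norm_ne_zero_iff.2 hx)))).exp

lemma exists_hasFDerivAt_stage {γ : ℝ} (hγ : 1 < γ) {x : EuclideanSpace ℝ (Fin n)}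
    (hx : x ≠ 0) :
    ∃ g : EuclideanSpace ℝ (Fin n) →L[ℝ] ℝ,
      HasFDerivAt (stage γ) g x ∧ ‖g‖ ≤ (γ - 1) * ‖x‖ ^ (-γ) := by
  have hx0 : 0 < ‖x‖ := norm_pos_iff.2 hx
  have h1 : DifferentiableAt ℝ (fun x : EuclideanSpace ℝ (Fin n) => ‖x‖) x :=
    (contDiffAt_norm ℝ hx).differentiableAt (n := 1) (by simp)
  have h1n : ‖fderiv ℝ (fun x : EuclideanSpace ℝ (Fin n) => ‖x‖) x‖ ≤ 1 := by
    have := norm_fderiv_le_of_lipschitz ℝ (x₀ := x)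
      (lipschitzWith_one_norm (E := EuclideanSpace ℝ (Fin n)))
    simpa using this
  have h2 := ((((h1.hasFDerivAt.log hx0.ne').const_add 1).const_mul (-(γ - 1))).exp)
  refine ⟨_, h2, ?_⟩
  have hs : Real.exp (-(γ - 1) * (1 + Real.log ‖x‖)) ≤ ‖x‖ ^ (-γ + 1) := by
    rw [Real.rpow_def_of_pos hx0]
    apply Real.exp_le_exp.2
    nlinarith
  rw [norm_smul, norm_smul, norm_smul, Real.norm_of_nonneg (Real.exp_pos _).le, norm_neg,
    Real.norm_of_nonneg (by linarith : 0 ≤ γ - 1), norm_inv, norm_norm]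
  calc _ ≤ ‖x‖ ^ (-γ + 1) * ((γ - 1) * (‖x‖⁻¹ * 1)) := by gcongr
    _ = (γ - 1) * ‖x‖ ^ (-γ) := by
      rw [Real.rpow_add_one hx0.ne']
      field_simp

lemma norm_eq_exp_log_stage {γ : ℝ} (hγ : 1 < γ) {x : EuclideanSpace ℝ (Fin n)} (hx : x ≠ 0) :
    ‖x‖ = Real.exp (-1 - (γ - 1)⁻¹ * Real.log (stage γ x)) := by
  have h : γ - 1 ≠ 0 := by linarith
  rw [stage, Real.log_exp]
  rw [show -1 - (γ - 1)⁻¹ * (-(γ - 1) * (1 + Real.log ‖x‖)) = Real.log ‖x‖ by field_simp; ring,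
    Real.exp_log (norm_pos_iff.2 hx)]

lemma norm_rpow_eq_stage {γ : ℝ} {x : EuclideanSpace ℝ (Fin n)} (hx : x ≠ 0) :
    (‖x‖ ^ (2 * γ - 2))⁻¹ = Real.exp (2 * (γ - 1)) * stage γ x ^ 2 := by
  rw [stage, Real.rpow_def_of_pos (norm_pos_iff.2 hx), ← Real.exp_neg, ← Real.exp_nat_mul,
    ← Real.exp_add]
  congr 1
  push_cast
  ring

/-- The radius at which the stage function takes the value `k + 1`, with `δ = 1 / (γ - 1)`. -/
noncomputable def transRadius (δ : ℝ) (k : ℕ) : ℝ := Real.exp (-1 - δ * Real.log (k + 1))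

lemma transRadius_pos (δ : ℝ) (k : ℕ) : 0 < transRadius δ k := Real.exp_pos _

lemma norm_le_transRadius {γ : ℝ} (hγ : 1 < γ) {x : EuclideanSpace ℝ (Fin n)} (hx : x ≠ 0)
    {k : ℕ} (h : k + 1 ≤ stage γ x) : ‖x‖ ≤ transRadius (γ - 1)⁻¹ k := by
  rw [norm_eq_exp_log_stage hγ hx, transRadius]
  have : 0 < (γ - 1)⁻¹ := inv_pos.2 (by linarith)
  gcongr

lemma transRadius_succ_le_norm {γ : ℝ} (hγ : 1 < γ) {x : EuclideanSpace ℝ (Fin n)} (hx : x ≠ 0)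
    {k : ℕ} (h : stage γ x ≤ k + 2) : transRadius (γ - 1)⁻¹ (k + 1) ≤ ‖x‖ := by
  rw [norm_eq_exp_log_stage hγ hx, transRadius]
  have : 0 < (γ - 1)⁻¹ := inv_pos.2 (by linarith)
  have := stage_pos γ x
  gcongr
  push_cast
  linarith

lemma transRadius_succ (δ : ℝ) (k : ℕ) : transRadius δ (k + 1) =
    transRadius δ k * Real.exp (-(δ * Real.log ((k + 2) / (k + 1)))) := by
  rw [transRadius, transRadius, ← Real.exp_add, Real.log_div (by positivity) (by positivity)]
  congr 1
  push_cast
  rw [show (k : ℝ) + 1 + 1 = k + 2 by ring]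
  ring

lemma inv_le_log_ratio (k : ℕ) : 1 / ((k : ℝ) + 2) ≤ Real.log ((k + 2) / (k + 1)) := by
  have h := Real.one_sub_inv_le_log_of_pos (x := ((k : ℝ) + 2) / (k + 1)) (by positivity)
  refine le_trans (le_of_eq ?_) h
  field_simp
  ring

lemma log_ratio_le_inv (k : ℕ) : Real.log (((k : ℝ) + 2) / (k + 1)) ≤ 1 / (k + 1) := by
  have h := Real.log_le_sub_one_of_pos (x := ((k : ℝ) + 2) / (k + 1)) (by positivity)
  refine h.trans (le_of_eq ?_)
  field_simp
  ring

/-- The amplitudes that balance the fields of degrees `(k + 1)²` and `(k + 2)²` at the radius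
`transRadius δ k`; note that `(k + 2)² - (k + 1)² = 2 k + 3`. -/
noncomputable def amplitude (δ : ℝ) : ℕ → ℝ
  | 0 => 1
  | k + 1 => amplitude δ k * (transRadius δ k ^ (2 * k + 3))⁻¹

lemma amplitude_pos (δ : ℝ) (k : ℕ) : 0 < amplitude δ k := by
  induction k with
  | zero => exact one_pos
  | succ k ih => exact mul_pos ih (inv_pos.2 (pow_pos (transRadius_pos δ k) _))

lemma amplitude_succ_mul_pow (δ : ℝ) (k : ℕ) :
    amplitude δ (k + 1) * transRadius δ k ^ (k + 2) ^ 2 =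
      amplitude δ k * transRadius δ k ^ (k + 1) ^ 2 := by
  have := (pow_pos (transRadius_pos δ k) (2 * k + 3)).ne'
  rw [amplitude, show (k + 2) ^ 2 = (2 * k + 3) + (k + 1) ^ 2 by ring, pow_add _ (2 * k + 3),
    mul_assoc, inv_mul_cancel_left₀ this]

/-- At the transition radii the degree `(k + 1)²` is of the order of the square of the stage, and
the logarithmic decrements, at least `δ (k + 2)`, add up to about `δ k² / 2`. -/
lemma amplitude_mul_pow_le {δ : ℝ} (hδ : 0 < δ) (k : ℕ) :
    amplitude δ k * transRadius δ k ^ (k + 1) ^ 2 ≤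
      Real.exp (δ / 2) * Real.exp (-(δ * (k + 1) ^ 2 / 2)) := by
  induction k with
  | zero =>
    rw [← Real.exp_add]
    simp only [amplitude, transRadius]
    rw [one_mul, ← Real.exp_nat_mul]
    apply Real.exp_le_exp.2
    simp
  | succ k ih =>
    calc amplitude δ (k + 1) * transRadius δ (k + 1) ^ (k + 1 + 1) ^ 2
        = amplitude δ (k + 1) * transRadius δ k ^ (k + 2) ^ 2 *
            Real.exp (-(δ * Real.log ((k + 2) / (k + 1)))) ^ (k + 2) ^ 2 := by
          rw [transRadius_succ, mul_pow, mul_assoc]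
      _ ≤ Real.exp (δ / 2) * Real.exp (-(δ * (k + 1) ^ 2 / 2)) *
            Real.exp (-(δ * Real.log ((k + 2) / (k + 1)))) ^ (k + 2) ^ 2 := by
          rw [amplitude_succ_mul_pow]
          gcongr
      _ ≤ Real.exp (δ / 2) * Real.exp (-(δ * (k + 1) ^ 2 / 2)) * Real.exp (-(δ * (k + 2))) := by
          rw [← Real.exp_nat_mul]
          gcongr
          have h := mul_le_mul_of_nonneg_left (inv_le_log_ratio k)
            (by positivity : 0 ≤ δ * ((k : ℝ) + 2) ^ 2)
          have h2 : δ * ((k : ℝ) + 2) ^ 2 * (1 / (k + 2)) = δ * (k + 2) := by field_simp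
          push_cast
          nlinarith
      _ ≤ _ := by
          rw [mul_assoc, ← Real.exp_add]
          gcongr
          push_cast
          nlinarith

lemma le_transRadius_succ_pow {δ : ℝ} (hδ : 0 < δ) (k : ℕ) :
    Real.exp (-(3 * δ)) * transRadius δ k ^ (2 * k + 3) ≤
      transRadius δ (k + 1) ^ (2 * k + 3) := by
  rw [transRadius_succ, mul_pow, mul_comm, ← Real.exp_nat_mul]
  have := (transRadius_pos δ k).le
  gcongr
  have h := mul_le_mul_of_nonneg_left (log_ratio_le_inv k)
    (by positivity : 0 ≤ δ * (2 * (k : ℝ) + 3))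
  have h2 : δ * (2 * (k : ℝ) + 3) * (1 / (k + 1)) ≤ 3 * δ := by
    rw [mul_one_div, div_le_iff₀ (by positivity)]
    nlinarith [(Nat.cast_nonneg k : (0 : ℝ) ≤ k)]
  push_cast
  nlinarith

lemma pow_mul_exp_neg_le {c : ℝ} (hc : 0 < c) (N : ℕ) {t : ℝ} (ht : 1 ≤ t) :
    t ^ N * Real.exp (-(c * t ^ 2)) ≤ N.factorial / c ^ N := by
  have h := Real.pow_div_factorial_le_exp (c * t ^ 2) (by positivity) N
  rw [Real.exp_neg, ← div_eq_mul_inv, div_le_div_iff₀ (Real.exp_pos _) (by positivity)]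
  rw [div_le_iff₀ (by positivity)] at h
  calc t ^ N * c ^ N ≤ (t ^ 2) ^ N * c ^ N := by
        gcongr
        nlinarith
    _ = (c * t ^ 2) ^ N := by rw [mul_pow]; ring
    _ ≤ _ := by linarith

lemma exp_mul_log_le_pow {p t : ℝ} (ht : 1 ≤ t) :
    Real.exp (p * Real.log t) ≤ t ^ ⌈p⌉₊ := by
  rw [← Real.rpow_natCast, Real.rpow_def_of_pos (by linarith)]
  apply Real.exp_le_exp.2
  rw [mul_comm]
  exact mul_le_mul_of_nonneg_left (Nat.le_ceil p) (Real.log_nonneg ht)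

end Stage

/-! ### Comparison of consecutive stages -/

section StageField

variable {n : ℕ} {a : EuclideanSpace ℝ (Fin n)} {γ : ℝ}

/-- The field of stage `k`: the decaying field for `k = 0`, the axial field of degree `(k + 1)²`
for `k ≥ 1`. -/
noncomputable def stageField (a : EuclideanSpace ℝ (Fin n)) (k : ℕ)
    (x : EuclideanSpace ℝ (Fin n)) : EuclideanSpace ℝ (Fin n) :=
  if k = 0 then dipoleField a x else axialField a ((k + 1) ^ 2) x

lemma contDiffAt_stageField (k : ℕ) {x : EuclideanSpace ℝ (Fin n)} (hx : x ≠ 0) :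
    ContDiffAt ℝ ∞ (stageField a k) x := by
  unfold stageField
  split_ifs
  · exact contDiffAt_dipoleField hx
  · exact (contDiff_axialField _).contDiffAt

lemma exists_hasFDerivAt_stageField (hn : 2 ≤ n) (ha : ‖a‖ = 1) (k : ℕ)
    {x : EuclideanSpace ℝ (Fin n)} (hx : x ≠ 0) :
    ∃ L, HasFDerivAt (stageField a k) L x ∧ IsSymmTraceless L ∧
      (k = 0 → ‖x‖ ^ (n + 1) * ‖L‖ ≤ n ^ 2 + 5 * n) ∧
      (k ≠ 0 → ‖x‖ * ‖L‖ ≤ 8 * ((k + 1) ^ 2 + 1) ^ 2 * ‖x‖ ^ (k + 1) ^ 2) := by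
  by_cases hk : k = 0
  · obtain ⟨L, h1, h2, h3⟩ := exists_hasFDerivAt_dipoleField ha hx
    refine ⟨L, ?_, h2, fun _ => h3, fun h => absurd hk h⟩
    unfold stageField
    simpa only [hk, if_true] using h1
  · obtain ⟨L, h1, h2, h3⟩ := exists_hasFDerivAt_axialField hn ha ((k + 1) ^ 2) x
    refine ⟨L, ?_, h2, fun h => absurd h hk, fun _ => by exact_mod_cast h3⟩
    unfold stageField
    simpa only [hk, if_false] using h1

/-- The size `cₖ |Fₖ(x)|` of the field of stage `k` with its amplitude. -/
noncomputable def profile (γ : ℝ) (a : EuclideanSpace ℝ (Fin n)) (k : ℕ)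
    (x : EuclideanSpace ℝ (Fin n)) : ℝ :=
  amplitude (γ - 1)⁻¹ k * ‖stageField a k x‖

lemma profile_nonneg (k : ℕ) (x : EuclideanSpace ℝ (Fin n)) : 0 ≤ profile γ a k x :=
  mul_nonneg (amplitude_pos _ _).le (norm_nonneg _)

lemma amplitude_mul_norm_pow_le (hγ : 1 < γ) {k : ℕ} {x : EuclideanSpace ℝ (Fin n)} (hx : x ≠ 0)
    (h1 : k + 1 ≤ stage γ x) {j : ℕ} (hj : j = k ∨ j = k + 1) :
    amplitude (γ - 1)⁻¹ j * ‖x‖ ^ (j + 1) ^ 2 ≤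
      Real.exp ((γ - 1)⁻¹ / 2) * Real.exp (-((γ - 1)⁻¹ * (k + 1) ^ 2 / 2)) := by
  have hδ : 0 < (γ - 1)⁻¹ := inv_pos.2 (by linarith)
  have hr := norm_le_transRadius hγ hx h1
  have hc := (amplitude_pos (γ - 1)⁻¹ j).le
  refine le_trans ?_ (amplitude_mul_pow_le hδ k)
  rcases hj with rfl | rfl
  · gcongr
  · rw [← amplitude_succ_mul_pow]
    gcongr

lemma exp_transition_le (hγ : 1 < γ) {k : ℕ} {s : ℝ} (hs : 0 < s) (h2 : s ≤ k + 2) :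
    Real.exp (-((γ - 1)⁻¹ * (k + 1) ^ 2 / 2)) ≤ Real.exp (-((γ - 1)⁻¹ / 8 * s ^ 2)) := by
  have hδ : 0 < (γ - 1)⁻¹ := inv_pos.2 (by linarith)
  apply Real.exp_le_exp.2
  have : s ^ 2 ≤ 4 * ((k : ℝ) + 1) ^ 2 := by
    nlinarith [(Nat.cast_nonneg k : (0 : ℝ) ≤ k)]
  nlinarith

lemma profile_zero_le (hn : 2 ≤ n) (ha : ‖a‖ = 1) {x : EuclideanSpace ℝ (Fin n)} (hx : x ≠ 0) :
    profile γ a 0 x ≤ n * (‖x‖ ^ n)⁻¹ := by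
  simpa [profile, stageField, amplitude] using norm_dipoleField_le hn ha hx

lemma profile_succ_le (hn : 2 ≤ n) (ha : ‖a‖ = 1) {k : ℕ} (hk : k ≠ 0)
    (x : EuclideanSpace ℝ (Fin n)) :
    profile γ a k x ≤ amplitude (γ - 1)⁻¹ k * ‖x‖ ^ (k + 1) ^ 2 := by
  rw [profile, stageField, if_neg hk]
  exact mul_le_mul_of_nonneg_left (norm_axialField_le hn ha _ x) (amplitude_pos _ _).le

lemma exists_profile_le (hγ : 1 < γ) (hn : 2 ≤ n) (ha : ‖a‖ = 1) :
    ∃ D : ℝ, 0 < D ∧ ∀ (k : ℕ) (x : EuclideanSpace ℝ (Fin n)), x ≠ 0 → k + 1 ≤ stage γ x →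
      stage γ x ≤ k + 2 → ∀ j, j = k ∨ j = k + 1 →
        profile γ a j x ≤ D * Real.exp (-((γ - 1)⁻¹ / 8 * stage γ x ^ 2)) := by
  set δ := (γ - 1)⁻¹ with hδdef
  have hδ : 0 < δ := inv_pos.2 (by linarith)
  set D0 : ℝ := n * (transRadius δ 1 ^ n)⁻¹ * Real.exp (δ / 2)
  have hρ := transRadius_pos δ 1
  have hD0 : 0 ≤ D0 := by positivity
  refine ⟨Real.exp (δ / 2) + D0, by positivity, fun k x hx h1 h2 j hj => ?_⟩
  have hs := stage_pos γ x
  rw [add_mul]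
  by_cases hj0 : j = 0
  · have hk : k = 0 := by omega
    subst hj0 hk
    have hr := transRadius_succ_le_norm hγ hx h2
    have h3 : D0 * Real.exp (-(δ / 8 * stage γ x ^ 2)) ≥ n * (transRadius δ 1 ^ n)⁻¹ := by
      have : Real.exp (-(δ / 2)) ≤ Real.exp (-(δ / 8 * stage γ x ^ 2)) := by
        apply Real.exp_le_exp.2
        simp only [Nat.cast_zero, zero_add] at h2
        have : stage γ x ^ 2 ≤ 4 := by nlinarith
        nlinarith
      calc (n : ℝ) * (transRadius δ 1 ^ n)⁻¹ = D0 * Real.exp (-(δ / 2)) := by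
            rw [mul_assoc, ← Real.exp_add, add_neg_cancel, Real.exp_zero, mul_one]
        _ ≤ _ := by gcongr
    have h4 : profile γ a 0 x ≤ n * (transRadius δ 1 ^ n)⁻¹ :=
      (profile_zero_le hn ha hx).trans (by gcongr)
    have : 0 ≤ Real.exp (δ / 2) * Real.exp (-(δ / 8 * stage γ x ^ 2)) := by positivity
    linarith
  · have h3 := (profile_succ_le (γ := γ) hn ha hj0 x).trans
      (amplitude_mul_norm_pow_le hγ hx h1 hj)
    have h4 := exp_transition_le hγ hs h2
    have h5 := mul_le_mul_of_nonneg_left h4 (Real.exp_pos (δ / 2)).le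
    have : 0 ≤ D0 * Real.exp (-(δ / 8 * stage γ x ^ 2)) := by positivity
    linarith

/-- On a transition annulus the two active stages have comparable size, uniformly in the stage. -/
lemma exists_profile_comparable (hγ : 1 < γ) (hn : 2 ≤ n) (hn3 : n ≤ 3) (ha : ‖a‖ = 1) :
    ∃ K : ℝ, 1 ≤ K ∧ ∀ (k : ℕ) (x : EuclideanSpace ℝ (Fin n)), x ≠ 0 → k + 1 ≤ stage γ x →
      stage γ x ≤ k + 2 →
        profile γ a k x ≤ K * profile γ a (k + 1) x ∧ profile γ a (k + 1) x ≤ profile γ a k x := by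
  set δ := (γ - 1)⁻¹ with hδdef
  have hδ : 0 < δ := inv_pos.2 (by linarith)
  have hρ := transRadius_pos δ 1
  have hc := amplitude_pos δ 1
  have hn0 : (0 : ℝ) < n := by exact_mod_cast (by omega : 0 < n)
  set q : ℝ := amplitude δ 1 * (1 / 5 * transRadius δ 1 ^ 4) with hq
  have hq0 : 0 < q := by positivity
  set K0 : ℝ := n * (transRadius δ 1 ^ n)⁻¹ / q with hK0
  have hK00 : 0 < K0 := by positivity
  refine ⟨4 * Real.exp (3 * δ) + K0, ?_, fun k x hx h1 h2 => ?_⟩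
  · linarith [Real.one_le_exp (by positivity : 0 ≤ 3 * δ)]
  have hx0 : 0 < ‖x‖ := norm_pos_iff.2 hx
  have hr1 := norm_le_transRadius hγ hx h1
  have hr2 := transRadius_succ_le_norm hγ hx h2
  rw [← hδdef] at hr1 hr2
  have hp1 := profile_nonneg (γ := γ) (a := a) (k + 1) x
  rw [add_mul]
  by_cases hk : k = 0
  · subst hk
    constructor
    · have h3 : q ≤ profile γ a 1 x := by
        have := le_norm_axialField_add hn hn3 ha 0 4 x
        rw [norm_axialField_zero ha] at this
        norm_num at this
        rw [profile, stageField, if_neg one_ne_zero, hq]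
        norm_num
        gcongr
        refine le_trans ?_ this
        gcongr
      have h4 : profile γ a 0 x ≤ n * (transRadius δ 1 ^ n)⁻¹ :=
        (profile_zero_le hn ha hx).trans (by gcongr)
      have h5 : n * (transRadius δ 1 ^ n)⁻¹ = K0 * q := by rw [hK0]; field_simp
      have h6 : K0 * q ≤ K0 * profile γ a 1 x := by gcongr
      have h7 : 0 ≤ 4 * Real.exp (3 * δ) * profile γ a 1 x := by positivity
      linarith
    · have hle : ‖x‖ ≤ 1 := hr1.trans (by simp [transRadius])
      have h3 : 1 ≤ profile γ a 0 x := by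
        have := le_norm_dipoleField hn ha hx
        simp only [profile, stageField, amplitude, if_true, one_mul]
        exact le_trans (one_le_inv_iff₀.2 ⟨by positivity, pow_le_one₀ hx0.le hle⟩) this
      have h4 := (profile_succ_le (γ := γ) hn ha one_ne_zero x).trans
        (amplitude_mul_norm_pow_le hγ hx h1 (Or.inr rfl))
      refine h4.trans (le_trans (le_of_eq ?_) h3)
      rw [← Real.exp_add]
      simp
  · have hdeg : (k + 1 + 1) ^ 2 = (k + 1) ^ 2 + (2 * k + 3) := by ring
    have hup := norm_axialField_add_le hn ha ((k + 1) ^ 2) (2 * k + 3) x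
    have hlow := le_norm_axialField_add hn hn3 ha ((k + 1) ^ 2) (2 * k + 3) x
    have hρk := transRadius_pos δ k
    have hck := (amplitude_pos δ k).le
    simp only [profile, stageField, if_neg hk, if_neg k.succ_ne_zero, hdeg, amplitude,
      ← hδdef] at hp1 ⊢
    set X := ‖axialField a ((k + 1) ^ 2) x‖ with hX
    set Y := ‖axialField a ((k + 1) ^ 2 + (2 * k + 3)) x‖
    have hX0 : 0 ≤ X := norm_nonneg _
    constructor
    · have h4 : (1 : ℝ) / 4 ≤
          (((k + 1) ^ 2 : ℕ) + 1) / (((k + 1) ^ 2 : ℕ) + (2 * k + 3 : ℕ) + 1) := by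
        rw [div_le_div_iff₀ (by norm_num) (by positivity)]
        push_cast
        nlinarith [(Nat.cast_nonneg k : (0 : ℝ) ≤ k)]
      have h5 : Real.exp (-(3 * δ)) * transRadius δ k ^ (2 * k + 3) ≤ ‖x‖ ^ (2 * k + 3) :=
        (le_transRadius_succ_pow hδ k).trans (by have := (transRadius_pos δ (k + 1)).le; gcongr)
      have h6 : 1 / 4 * (Real.exp (-(3 * δ)) * transRadius δ k ^ (2 * k + 3) * X) ≤ Y :=
        le_trans (by gcongr) hlow
      have h7 : amplitude δ k * X = 4 * Real.exp (3 * δ) * (amplitude δ k *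
          (transRadius δ k ^ (2 * k + 3))⁻¹ *
          (1 / 4 * (Real.exp (-(3 * δ)) * transRadius δ k ^ (2 * k + 3) * X))) := by
        have he : Real.exp (3 * δ) * Real.exp (-(3 * δ)) = 1 := by
          rw [← Real.exp_add, add_neg_cancel, Real.exp_zero]
        have hi : (transRadius δ k ^ (2 * k + 3))⁻¹ * transRadius δ k ^ (2 * k + 3) = 1 :=
          inv_mul_cancel₀ (pow_pos hρk _).ne'
        linear_combination (-amplitude δ k * X) * he -
          (amplitude δ k * X * Real.exp (3 * δ) * Real.exp (-(3 * δ))) * hi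
      have h8 := mul_nonneg hK00.le hp1
      have h9 : 4 * Real.exp (3 * δ) * (amplitude δ k * (transRadius δ k ^ (2 * k + 3))⁻¹ *
          (1 / 4 * (Real.exp (-(3 * δ)) * transRadius δ k ^ (2 * k + 3) * X))) ≤
          4 * Real.exp (3 * δ) * (amplitude δ k * (transRadius δ k ^ (2 * k + 3))⁻¹ * Y) := by
        gcongr
      linarith
    · rw [mul_assoc]
      gcongr
      rw [inv_mul_le_iff₀ (by positivity)]
      exact hup.trans (by gcongr)

lemma profile_pos (hn : 2 ≤ n) (hn3 : n ≤ 3) (ha : ‖a‖ = 1) (k : ℕ)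
    {x : EuclideanSpace ℝ (Fin n)} (hx : x ≠ 0) : 0 < profile γ a k x := by
  have hx0 : 0 < ‖x‖ := norm_pos_iff.2 hx
  refine mul_pos (amplitude_pos _ _) ?_
  unfold stageField
  split_ifs
  · exact lt_of_lt_of_le (by positivity) (le_norm_dipoleField hn ha hx)
  · have := le_norm_axialField_add hn hn3 ha 0 ((k + 1) ^ 2) x
    rw [norm_axialField_zero ha, zero_add] at this
    exact lt_of_lt_of_le (by positivity) this

/-- The derivatives of the active fields lose only powers of the stage and stay bounded. -/
lemma exists_amplitude_mul_norm_fderiv_le (hγ : 1 < γ) (hn : 2 ≤ n) :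
    ∃ G : ℝ, 0 < G ∧ ∀ (k : ℕ) (x : EuclideanSpace ℝ (Fin n)), x ≠ 0 → k + 1 ≤ stage γ x →
      stage γ x ≤ k + 2 → ∀ j, j = k ∨ j = k + 1 →
        ∀ L : EuclideanSpace ℝ (Fin n) →L[ℝ] EuclideanSpace ℝ (Fin n),
          (j = 0 → ‖x‖ ^ (n + 1) * ‖L‖ ≤ n ^ 2 + 5 * n) →
          (j ≠ 0 → ‖x‖ * ‖L‖ ≤ 8 * ((j + 1) ^ 2 + 1) ^ 2 * ‖x‖ ^ (j + 1) ^ 2) →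
          amplitude (γ - 1)⁻¹ j * ‖L‖ ≤ G := by
  set δ := (γ - 1)⁻¹ with hδdef
  have hδ : 0 < δ := inv_pos.2 (by linarith)
  have hρ := transRadius_pos δ 1
  set G0 : ℝ := (n ^ 2 + 5 * n) / transRadius δ 1 ^ (n + 1) with hG0
  have hG00 : 0 ≤ G0 := by positivity
  set N := ⌈δ⌉₊
  set G1 : ℝ := 32 * Real.exp (δ / 2) * Real.exp 1 *
    ((4 + N).factorial / (δ / 8) ^ (4 + N)) with hG1
  have hG10 : 0 < G1 := by positivity
  refine ⟨G0 + G1, by positivity, fun k x hx h1 h2 j hj L hL0 hL1 => ?_⟩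
  have hx0 : 0 < ‖x‖ := norm_pos_iff.2 hx
  have hr2 := transRadius_succ_le_norm hγ hx h2
  rw [← hδdef] at hr2
  by_cases hj0 : j = 0
  · have hk : k = 0 := by omega
    subst hj0 hk
    have : ‖L‖ ≤ G0 := by
      rw [hG0, le_div_iff₀ (by positivity)]
      calc ‖L‖ * transRadius δ 1 ^ (n + 1) ≤ ‖L‖ * ‖x‖ ^ (n + 1) := by
            gcongr
        _ = ‖x‖ ^ (n + 1) * ‖L‖ := mul_comm _ _
        _ ≤ _ := hL0 rfl
    simp only [amplitude, one_mul]
    linarith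
  · have hA := amplitude_mul_norm_pow_le hγ hx h1 hj
    rw [← hδdef] at hA
    have hcj := (amplitude_pos δ j).le
    set t : ℝ := (k : ℝ) + 2 with ht
    have hk0 : (0 : ℝ) ≤ k := k.cast_nonneg
    have ht1 : 1 ≤ t := by linarith
    have hjt : (j : ℝ) + 1 ≤ t := by
      rcases hj with rfl | rfl
      · linarith
      · push_cast; linarith
    have hdeg : 8 * (((j : ℝ) + 1) ^ 2 + 1) ^ 2 ≤ 32 * t ^ 4 := by
      have h3 : ((j : ℝ) + 1) ^ 2 + 1 ≤ 2 * t ^ 2 := by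
        have : ((j : ℝ) + 1) ^ 2 ≤ t ^ 2 := by gcongr
        nlinarith
      calc 8 * (((j : ℝ) + 1) ^ 2 + 1) ^ 2 ≤ 8 * (2 * t ^ 2) ^ 2 := by gcongr
        _ = 32 * t ^ 4 := by ring
    have hinv : ‖x‖⁻¹ ≤ Real.exp 1 * t ^ N := by
      have h3 : (transRadius δ (k + 1))⁻¹ = Real.exp 1 * Real.exp (δ * Real.log t) := by
        rw [transRadius, ← Real.exp_neg, ← Real.exp_add]
        congr 1
        push_cast
        rw [ht, show (k : ℝ) + 1 + 1 = k + 2 by ring]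
        ring
      calc ‖x‖⁻¹ ≤ (transRadius δ (k + 1))⁻¹ := by
            gcongr
            exact transRadius_pos _ _
        _ ≤ _ := by
            rw [h3]
            gcongr
            exact exp_mul_log_le_pow ht1
    have he : Real.exp (-(δ * ((k : ℝ) + 1) ^ 2 / 2)) ≤ Real.exp (-(δ / 8 * t ^ 2)) :=
      exp_transition_le hγ (by linarith) le_rfl
    have hpe := pow_mul_exp_neg_le (by positivity : 0 < δ / 8) (4 + N) ht1
    have hLx : ‖L‖ ≤ ‖x‖⁻¹ * (8 * ((j + 1) ^ 2 + 1) ^ 2 * ‖x‖ ^ (j + 1) ^ 2) := by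
      rw [inv_mul_eq_div, le_div_iff₀ hx0, mul_comm]
      exact hL1 hj0
    calc amplitude δ j * ‖L‖
        ≤ amplitude δ j * (‖x‖⁻¹ * (8 * ((j + 1) ^ 2 + 1) ^ 2 * ‖x‖ ^ (j + 1) ^ 2)) := by gcongr
      _ = (8 * ((j + 1) ^ 2 + 1) ^ 2) * ‖x‖⁻¹ * (amplitude δ j * ‖x‖ ^ (j + 1) ^ 2) := by ring
      _ ≤ (32 * t ^ 4) * (Real.exp 1 * t ^ N) *
            (Real.exp (δ / 2) * Real.exp (-(δ / 8 * t ^ 2))) := by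
          refine mul_le_mul (by gcongr) (hA.trans (by gcongr)) (by positivity) (by positivity)
      _ = 32 * Real.exp (δ / 2) * Real.exp 1 *
            (t ^ (4 + N) * Real.exp (-(δ / 8 * t ^ 2))) := by rw [pow_add]; ring
      _ ≤ G1 := by rw [hG1]; gcongr
      _ ≤ G0 + G1 := by linarith

end StageField

/-! ### A criterion for membership in `H¹` -/

section Sobolev

variable {n : ℕ}

lemma memLp_two_of_norm_le (hn : 0 < n) {u : EuclideanSpace ℝ (Fin n) → Spinor n}
    (hu : AEStronglyMeasurable u volume) {C : ℝ}
    (hC : ∀ x, ‖u x‖ ≤ C * ((1 + ‖x‖) ^ n)⁻¹) : MemLp u 2 volume := by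
  have hb : MemLp (fun x : EuclideanSpace ℝ (Fin n) => C * ((1 + ‖x‖) ^ n)⁻¹) 2 volume := by
    have hc : Continuous fun x : EuclideanSpace ℝ (Fin n) => ((1 + ‖x‖) ^ n)⁻¹ :=
      ((continuous_const.add continuous_norm).pow n).inv₀ fun x =>
        (by positivity : (0 : ℝ) < (1 + ‖x‖) ^ n).ne'
    refine MemLp.const_mul ((memLp_two_iff_integrable_sq hc.aestronglyMeasurable).2 ?_) C
    have h := integrable_one_add_norm (E := EuclideanSpace ℝ (Fin n)) (μ := volume)
      (r := (2 * n : ℕ)) (by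
        rw [finrank_euclideanSpace_fin]
        exact_mod_cast (by omega : n < 2 * n))
    refine h.congr (Filter.Eventually.of_forall fun x => ?_)
    simp only
    rw [Real.rpow_neg (by positivity), Real.rpow_natCast, inv_pow, ← pow_mul, mul_comm]
  exact hb.mono hu (Filter.Eventually.of_forall fun x => (hC x).trans (Real.le_norm_self _))

lemma memH1_of_differentiable (hn : 0 < n) {u : EuclideanSpace ℝ (Fin n) → Spinor n}
    (hd : Differentiable ℝ u) {C : ℝ} (hC : ∀ x, ‖u x‖ ≤ C * ((1 + ‖x‖) ^ n)⁻¹)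
    (hC' : ∀ x, ‖fderiv ℝ u x‖ ≤ C * ((1 + ‖x‖) ^ n)⁻¹) : MemH1 u := by
  refine ⟨memLp_two_of_norm_le hn hd.continuous.aestronglyMeasurable hC,
    fun j => ⟨partialDeriv j u, ?_, fun φ hφ hφc => ?_⟩⟩
  all_goals
    have hm : AEStronglyMeasurable (partialDeriv j u) volume :=
      (measurable_fderiv_apply_const ℝ u _).aestronglyMeasurable
    have hb : ∀ x, ‖partialDeriv j u x‖ ≤ C * ((1 + ‖x‖) ^ n)⁻¹ := fun x =>
      ((fderiv ℝ u x).le_opNorm _).trans (by simpa using hC' x)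
  · exact memLp_two_of_norm_le hn hm hb
  · have hφi : Integrable φ volume := hφ.continuous.integrable_of_hasCompactSupport hφc
    have hφ'c : Continuous fun x => fderiv ℝ φ x (EuclideanSpace.single j 1) :=
      (hφ.continuous_fderiv (by simp)).clm_apply continuous_const
    have hφ's : HasCompactSupport fun x => fderiv ℝ φ x (EuclideanSpace.single j 1) :=
      hφc.fderiv_apply ℝ _
    have hbdd : ∀ x, ‖partialDeriv j u x‖ ≤ C := fun x => by
      have hC0 : 0 ≤ C := by
        have := (norm_nonneg _).trans (hC 0)
        simpa using this
      exact (hb x).trans (mul_le_of_le_one_right hC0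
        (inv_le_one_of_one_le₀ (one_le_pow₀ (by linarith [norm_nonneg x]))))
    have h := integral_smul_fderiv_eq_neg_fderiv_smul_of_integrable (μ := volume)
      (f := φ) (g := u) (v := EuclideanSpace.single j 1)
      ((hφ'c.smul hd.continuous).integrable_of_hasCompactSupport hφ's.smul_right)
      (hφi.smul_bdd C hm (Filter.Eventually.of_forall hbdd))
      ((hφ.continuous.smul hd.continuous).integrable_of_hasCompactSupport hφc.smul_right)
      (fun x _ => hφ.differentiable (by simp) x) (fun x _ => hd x)
    simp only [partialDeriv]
    rw [h, neg_neg]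

end Sobolev

/-! ### The solution -/

section Solution

variable {n : ℕ} {α : Fin (n + 1) → Matrix (Fin (spinorDim n)) (Fin (spinorDim n)) ℂ}
  {e : Spinor n} {a : EuclideanSpace ℝ (Fin n)} {γ : ℝ}

/-- The spinor carrying stage `k`: alternately `e` and `β e`, so that consecutive stages are
orthogonal. -/
noncomputable def stageSpinor
    (α : Fin (n + 1) → Matrix (Fin (spinorDim n)) (Fin (spinorDim n)) ℂ) (e : Spinor n) (k : ℕ) :
    Spinor n :=
  if Even k then e else gammaOp α (Fin.last n) e

/-- The vector field of stage `k` with its amplitude and cutoff. -/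
noncomputable def stageVec (γ : ℝ) (a : EuclideanSpace ℝ (Fin n)) (k : ℕ)
    (x : EuclideanSpace ℝ (Fin n)) : EuclideanSpace ℝ (Fin n) :=
  (weight k (stage γ x) * amplitude (γ - 1)⁻¹ k) • stageField a k x

/-- The spinor field `∑ₖ slash (stageSpinor k) (stageVec k)`. The sum stops where all further
terms vanish. -/
noncomputable def stagedSpinor
    (α : Fin (n + 1) → Matrix (Fin (spinorDim n)) (Fin (spinorDim n)) ℂ) (e : Spinor n)
    (γ : ℝ) (a : EuclideanSpace ℝ (Fin n)) (x : EuclideanSpace ℝ (Fin n)) : Spinor n :=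
  ∑ k ∈ Finset.range (⌊stage γ x⌋₊ + 1), slash α (stageSpinor α e k) (stageVec γ a k x)

lemma norm_stageSpinor (hα : IsDiracMatrices n α) (hne : ‖e‖ = 1) (k : ℕ) :
    ‖stageSpinor α e k‖ = 1 := by
  unfold stageSpinor
  split_ifs
  · exact hne
  · rw [norm_gammaOp hα, hne]

lemma norm_sq_stage_add (hα : IsDiracMatrices n α) (hne : ‖e‖ = 1)
    (he : inner ℂ e (gammaOp α (Fin.last n) e) = 0) (k : ℕ) (ξ η : EuclideanSpace ℝ (Fin n)) :
    ‖slash α (stageSpinor α e k) ξ + slash α (stageSpinor α e (k + 1)) η‖ ^ 2 =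
      ‖ξ‖ ^ 2 + ‖η‖ ^ 2 := by
  by_cases hk : Even k
  · rw [stageSpinor, stageSpinor, if_pos hk, if_neg (by simpa [Nat.even_add_one] using hk)]
    exact norm_sq_slash_add_slash hα hne he ξ η
  · rw [stageSpinor, stageSpinor, if_neg hk, if_pos (by simpa [Nat.even_add_one] using hk),
      add_comm, add_comm (‖ξ‖ ^ 2)]
    exact norm_sq_slash_add_slash hα hne he η ξ

lemma norm_stageVec (k : ℕ) (x : EuclideanSpace ℝ (Fin n)) :
    ‖stageVec γ a k x‖ = weight k (stage γ x) * profile γ a k x := by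
  rw [stageVec, norm_smul, Real.norm_of_nonneg
    (mul_nonneg (weight_nonneg _ _) (amplitude_pos _ _).le), profile, mul_assoc]

lemma stageVec_eq_zero {k : ℕ} {x : EuclideanSpace ℝ (Fin n)} (h : weight k (stage γ x) = 0) :
    stageVec γ a k x = 0 := by
  rw [stageVec, h, zero_mul, zero_smul]

lemma stagedSpinor_eq_sum {K : ℕ} (hK : 1 ≤ K) {x : EuclideanSpace ℝ (Fin n)}
    (hx : stage γ x ≤ K) :
    stagedSpinor α e γ a x =
      ∑ k ∈ Finset.range K, slash α (stageSpinor α e k) (stageVec γ a k x) := by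
  have key : ∀ K₁ K₂ : ℕ, 1 ≤ K₁ → K₁ ≤ K₂ → stage γ x ≤ K₁ →
      ∑ k ∈ Finset.range K₁, slash α (stageSpinor α e k) (stageVec γ a k x) =
        ∑ k ∈ Finset.range K₂, slash α (stageSpinor α e k) (stageVec γ a k x) := by
    intro K₁ K₂ h1 h12 hs
    refine Finset.sum_subset (Finset.range_mono h12) fun k _ hk => ?_
    have hk' : K₁ ≤ k := by simpa using hk
    rw [stageVec_eq_zero, map_zero]
    exact weight_eq_zero_of_le (by omega) (hs.trans (by exact_mod_cast hk'))
  have hf : stage γ x ≤ (⌊stage γ x⌋₊ + 1 : ℕ) := by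
    push_cast
    exact (Nat.lt_floor_add_one _).le
  rw [stagedSpinor]
  rcases le_total K (⌊stage γ x⌋₊ + 1) with h | h
  · exact (key _ _ hK h hx).symm
  · exact key _ _ (by omega) h hf

lemma eventuallyEq_stagedSpinor {K : ℕ} (hK : 1 ≤ K) {x : EuclideanSpace ℝ (Fin n)} (hx : x ≠ 0)
    (hs : stage γ x < K) :
    stagedSpinor α e γ a =ᶠ[nhds x]
      fun x => ∑ k ∈ Finset.range K, slash α (stageSpinor α e k) (stageVec γ a k x) := by
  filter_upwards [(contDiffAt_stage γ hx).continuousAt.eventually_lt continuousAt_const hs]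
    with y hy
  exact stagedSpinor_eq_sum hK hy.le

lemma contDiffAt_stagedSpinor {x : EuclideanSpace ℝ (Fin n)} (hx : x ≠ 0) :
    ContDiffAt ℝ ∞ (stagedSpinor α e γ a) x := by
  have hf : stage γ x < (⌊stage γ x⌋₊ + 1 : ℕ) := by
    push_cast
    exact Nat.lt_floor_add_one _
  refine ContDiffAt.congr_of_eventuallyEq ?_ (eventuallyEq_stagedSpinor (by omega) hx hf)
  refine ContDiffAt.sum fun k _ => (slash α (stageSpinor α e k)).contDiff.contDiffAt.comp x ?_
  exact (((contDiff_weight k).contDiffAt.comp x (contDiffAt_stage γ hx)).mul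
    contDiffAt_const).smul (contDiffAt_stageField k hx)

/-- The derivative of `stageVec` in terms of the derivatives `L` of the field and `g` of the stage
function. -/
noncomputable def stageVecDeriv (γ : ℝ) (a : EuclideanSpace ℝ (Fin n)) (k : ℕ)
    (x : EuclideanSpace ℝ (Fin n)) (L : EuclideanSpace ℝ (Fin n) →L[ℝ] EuclideanSpace ℝ (Fin n))
    (g : EuclideanSpace ℝ (Fin n) →L[ℝ] ℝ) :
    EuclideanSpace ℝ (Fin n) →L[ℝ] EuclideanSpace ℝ (Fin n) :=
  (weight k (stage γ x) * amplitude (γ - 1)⁻¹ k) • L +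
    ((amplitude (γ - 1)⁻¹ k * deriv (weight k) (stage γ x)) • g).smulRight (stageField a k x)

lemma hasFDerivAt_stageVec {k : ℕ} {x : EuclideanSpace ℝ (Fin n)}
    {L : EuclideanSpace ℝ (Fin n) →L[ℝ] EuclideanSpace ℝ (Fin n)}
    {g : EuclideanSpace ℝ (Fin n) →L[ℝ] ℝ} (hL : HasFDerivAt (stageField a k) L x)
    (hg : HasFDerivAt (stage γ) g x) :
    HasFDerivAt (stageVec γ a k) (stageVecDeriv γ a k x L g) x := by
  have hw : HasDerivAt (weight k) (deriv (weight k) (stage γ x)) (stage γ x) :=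
    ((contDiff_weight k).differentiable (by simp) _).hasDerivAt
  refine (((hw.comp_hasFDerivAt x hg).mul_const (amplitude (γ - 1)⁻¹ k)).smul hL).congr_fderiv ?_
  rw [stageVecDeriv, smul_smul]
  rfl

lemma stageVecDeriv_eq_zero {k : ℕ} {x : EuclideanSpace ℝ (Fin n)}
    {L : EuclideanSpace ℝ (Fin n) →L[ℝ] EuclideanSpace ℝ (Fin n)}
    {g : EuclideanSpace ℝ (Fin n) →L[ℝ] ℝ} (h : weight k (stage γ x) = 0) :
    stageVecDeriv γ a k x L g = 0 := by
  rw [stageVecDeriv, h, deriv_weight_eq_zero h]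
  ext v
  simp

lemma norm_stageVecDeriv_le {M : ℝ} (hM : ∀ k s, |deriv (weight k) s| ≤ M) (k : ℕ)
    (x : EuclideanSpace ℝ (Fin n)) (L : EuclideanSpace ℝ (Fin n) →L[ℝ] EuclideanSpace ℝ (Fin n))
    (g : EuclideanSpace ℝ (Fin n) →L[ℝ] ℝ) :
    ‖stageVecDeriv γ a k x L g‖ ≤
      amplitude (γ - 1)⁻¹ k * ‖L‖ + M * ‖g‖ * profile γ a k x := by
  have hc := (amplitude_pos (γ - 1)⁻¹ k).le
  have hw := weight_nonneg k (stage γ x)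
  refine (norm_add_le _ _).trans (add_le_add ?_ ?_)
  · rw [norm_smul, Real.norm_of_nonneg (mul_nonneg hw hc)]
    gcongr
    exact mul_le_of_le_one_left hc (weight_le_one _ _)
  · rw [ContinuousLinearMap.norm_smulRight_apply, norm_smul, norm_mul, Real.norm_of_nonneg hc,
      profile, Real.norm_eq_abs]
    calc _ ≤ amplitude (γ - 1)⁻¹ k * M * ‖g‖ * ‖stageField a k x‖ := by
          gcongr
          exact hM _ _
      _ = _ := by ring

lemma hasFDerivAt_stagedSpinor_sum {K : ℕ} (hK : 1 ≤ K) {x : EuclideanSpace ℝ (Fin n)}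
    (hx : x ≠ 0) (hs : stage γ x < K)
    {L : ℕ → EuclideanSpace ℝ (Fin n) →L[ℝ] EuclideanSpace ℝ (Fin n)}
    {g : EuclideanSpace ℝ (Fin n) →L[ℝ] ℝ} (hL : ∀ k, HasFDerivAt (stageField a k) (L k) x)
    (hg : HasFDerivAt (stage γ) g x) :
    HasFDerivAt (stagedSpinor α e γ a) (∑ k ∈ Finset.range K,
      (slash α (stageSpinor α e k)).comp (stageVecDeriv γ a k x (L k) g)) x := by
  refine HasFDerivAt.congr_of_eventuallyEq ?_ (eventuallyEq_stagedSpinor hK hx hs)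
  exact HasFDerivAt.fun_sum fun k _ =>
    (slash α (stageSpinor α e k)).hasFDerivAt.comp x (hasFDerivAt_stageVec (hL k) hg)

lemma stagedSpinor_transition {k : ℕ} {x : EuclideanSpace ℝ (Fin n)}
    (h1 : k + 1 ≤ stage γ x) (h2 : stage γ x ≤ k + 2) :
    stagedSpinor α e γ a x = slash α (stageSpinor α e k) (stageVec γ a k x) +
      slash α (stageSpinor α e (k + 1)) (stageVec γ a (k + 1) x) := by
  rw [stagedSpinor_eq_sum (K := k + 2) (by omega) (by push_cast; exact h2),
    Finset.sum_range_succ, Finset.sum_range_succ, Finset.sum_eq_zero, zero_add]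
  intro j hj
  have hj' : (j : ℝ) + 1 ≤ k := by exact_mod_cast Finset.mem_range.1 hj
  rw [stageVec_eq_zero (weight_eq_zero_of_ge (by linarith)), map_zero]

lemma hasFDerivAt_stagedSpinor_transition {k : ℕ} {x : EuclideanSpace ℝ (Fin n)} (hx : x ≠ 0)
    (h1 : k + 1 ≤ stage γ x) (h2 : stage γ x ≤ k + 2)
    {L : ℕ → EuclideanSpace ℝ (Fin n) →L[ℝ] EuclideanSpace ℝ (Fin n)}
    {g : EuclideanSpace ℝ (Fin n) →L[ℝ] ℝ} (hL : ∀ k, HasFDerivAt (stageField a k) (L k) x)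
    (hg : HasFDerivAt (stage γ) g x) :
    HasFDerivAt (stagedSpinor α e γ a)
      ((slash α (stageSpinor α e k)).comp (stageVecDeriv γ a k x (L k) g) +
        (slash α (stageSpinor α e (k + 1))).comp
          (stageVecDeriv γ a (k + 1) x (L (k + 1)) g)) x := by
  have h := hasFDerivAt_stagedSpinor_sum (α := α) (e := e) (K := k + 3) (by omega) hx
    (by push_cast; linarith) hL hg
  have hz : stageVecDeriv γ a (k + 2) x (L (k + 2)) g = 0 :=
    stageVecDeriv_eq_zero (weight_eq_zero_of_le (by omega) (by push_cast; exact h2))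
  rw [Finset.sum_range_succ, Finset.sum_range_succ, Finset.sum_range_succ, Finset.sum_eq_zero,
    zero_add, hz, ContinuousLinearMap.comp_zero, add_zero] at h
  · exact h
  intro j hj
  have hj' : (j : ℝ) + 1 ≤ k := by exact_mod_cast Finset.mem_range.1 hj
  rw [stageVecDeriv_eq_zero (weight_eq_zero_of_ge (by linarith)), ContinuousLinearMap.comp_zero]

lemma stagedSpinor_outer {x : EuclideanSpace ℝ (Fin n)} (h : stage γ x ≤ 1) :
    stagedSpinor α e γ a x = slash α (stageSpinor α e 0) (dipoleField a x) := by
  rw [stagedSpinor_eq_sum (K := 1) le_rfl (by simpa using h), Finset.sum_range_one, stageVec,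
    weight_zero_of_le_one h]
  simp [amplitude, stageField]

lemma hasFDerivAt_stagedSpinor_outer {x : EuclideanSpace ℝ (Fin n)} (hx : x ≠ 0)
    (h : stage γ x ≤ 1)
    {L : ℕ → EuclideanSpace ℝ (Fin n) →L[ℝ] EuclideanSpace ℝ (Fin n)}
    {g : EuclideanSpace ℝ (Fin n) →L[ℝ] ℝ} (hL : ∀ k, HasFDerivAt (stageField a k) (L k) x)
    (hg : HasFDerivAt (stage γ) g x) :
    HasFDerivAt (stagedSpinor α e γ a) ((slash α (stageSpinor α e 0)).comp (L 0)) x := by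
  have h' := hasFDerivAt_stagedSpinor_sum (α := α) (e := e) (K := 2) (by omega) hx
    (by push_cast; linarith) hL hg
  have hz : stageVecDeriv γ a 1 x (L 1) g = 0 :=
    stageVecDeriv_eq_zero (weight_eq_zero_of_le (by omega) (by simpa using h))
  have h0 : stageVecDeriv γ a 0 x (L 0) g = L 0 := by
    rw [stageVecDeriv, weight_zero_of_le_one h, deriv_weight_zero_of_le_one h]
    ext v
    simp [amplitude]
  rwa [Finset.sum_range_succ, Finset.sum_range_one, hz, ContinuousLinearMap.comp_zero, add_zero,
    h0] at h'

end Solution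

/-! ### Estimates for the solution -/

section Estimates

variable {n : ℕ} {α : Fin (n + 1) → Matrix (Fin (spinorDim n)) (Fin (spinorDim n)) ℂ}
  {e : Spinor n} {a : EuclideanSpace ℝ (Fin n)} {γ : ℝ}

lemma exists_transition_index {s : ℝ} (hs : 1 ≤ s) : ∃ k : ℕ, k + 1 ≤ s ∧ s ≤ k + 2 := by
  have h1 : 1 ≤ ⌊s⌋₊ := Nat.one_le_floor_iff _ |>.2 hs
  refine ⟨⌊s⌋₊ - 1, ?_, ?_⟩
  · rw [Nat.cast_sub h1]
    simpa using Nat.floor_le (by linarith : 0 ≤ s)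
  · rw [Nat.cast_sub h1]
    have := (Nat.lt_floor_add_one s).le
    push_cast
    linarith

/-- Consecutive stages are orthogonal and their weights add up to `1`, so the solution is as large
as the sum of the two active stages. -/
lemma profile_add_profile_le (hα : IsDiracMatrices n α) (hne : ‖e‖ = 1)
    (he : inner ℂ e (gammaOp α (Fin.last n) e) = 0) {K : ℝ} {k : ℕ}
    {x : EuclideanSpace ℝ (Fin n)} (h1 : k + 1 ≤ stage γ x) (h2 : stage γ x ≤ k + 2)
    (hK1 : profile γ a k x ≤ K * profile γ a (k + 1) x)
    (hK2 : profile γ a (k + 1) x ≤ profile γ a k x) (hK : 1 ≤ K) :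
    profile γ a k x + profile γ a (k + 1) x ≤ (K + 3) * ‖stagedSpinor α e γ a x‖ := by
  have hsq := norm_sq_stage_add hα hne he k (stageVec γ a k x) (stageVec γ a (k + 1) x)
  rw [← stagedSpinor_transition h1 h2] at hsq
  have hu1 : ‖stageVec γ a k x‖ ≤ ‖stagedSpinor α e γ a x‖ :=
    (sq_le_sq₀ (norm_nonneg _) (norm_nonneg _)).1
      (by rw [hsq]; linarith [sq_nonneg ‖stageVec γ a (k + 1) x‖])
  have hu2 : ‖stageVec γ a (k + 1) x‖ ≤ ‖stagedSpinor α e γ a x‖ :=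
    (sq_le_sq₀ (norm_nonneg _) (norm_nonneg _)).1
      (by rw [hsq]; linarith [sq_nonneg ‖stageVec γ a k x‖])
  rw [norm_stageVec] at hu1 hu2
  have hw := weight_add_weight_succ h1 h2
  have hw1 := weight_nonneg k (stage γ x)
  have hw2 := weight_nonneg (k + 1) (stage γ x)
  set d := profile γ a k x
  set d' := profile γ a (k + 1) x
  set w := weight k (stage γ x)
  set w' := weight (k + 1) (stage γ x)
  calc d + d' = w * (d + d') + w' * (d + d') := by rw [← add_mul, hw, one_mul]
    _ ≤ w * (2 * d) + w' * ((K + 1) * d') := by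
        gcongr
        · linarith
        · linarith
    _ = 2 * (w * d) + (K + 1) * (w' * d') := by ring
    _ ≤ 2 * ‖stagedSpinor α e γ a x‖ + (K + 1) * ‖stagedSpinor α e γ a x‖ := by gcongr
    _ = _ := by ring

lemma norm_stagedSpinor_le_profile (hα : IsDiracMatrices n α) (hne : ‖e‖ = 1) {k : ℕ}
    {x : EuclideanSpace ℝ (Fin n)} (h1 : k + 1 ≤ stage γ x) (h2 : stage γ x ≤ k + 2) :
    ‖stagedSpinor α e γ a x‖ ≤ profile γ a k x + profile γ a (k + 1) x := by
  rw [stagedSpinor_transition h1 h2]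
  refine (norm_add_le _ _).trans (add_le_add ?_ ?_) <;>
  · rw [norm_slash hα, norm_stageSpinor hα hne, mul_one, norm_stageVec]
    exact mul_le_of_le_one_left (profile_nonneg _ _) (weight_le_one _ _)

lemma exp_neg_one_le_norm (hγ : 1 < γ) {x : EuclideanSpace ℝ (Fin n)} (hx : x ≠ 0)
    (hs : stage γ x ≤ 1) : Real.exp (-1) ≤ ‖x‖ := by
  rw [norm_eq_exp_log_stage hγ hx]
  apply Real.exp_le_exp.2
  have := mul_nonpos_of_nonneg_of_nonpos (inv_pos.2 (by linarith : 0 < γ - 1)).le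
    (Real.log_nonpos (stage_pos γ x).le hs)
  linarith

lemma norm_le_of_one_le_stage (hγ : 1 < γ) {x : EuclideanSpace ℝ (Fin n)} (hx : x ≠ 0)
    (hs : 1 ≤ stage γ x) : ‖x‖ ≤ Real.exp (-1) := by
  simpa [transRadius] using norm_le_transRadius hγ hx (k := 0) (by simpa using hs)

lemma exists_norm_stagedSpinor_le (hα : IsDiracMatrices n α) (hγ : 1 < γ) (hn : 2 ≤ n)
    (ha : ‖a‖ = 1) (hne : ‖e‖ = 1) :
    ∃ D : ℝ, 0 < D ∧ ∀ x : EuclideanSpace ℝ (Fin n), x ≠ 0 → 1 ≤ stage γ x →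
      ‖stagedSpinor α e γ a x‖ ≤ D * Real.exp (-((γ - 1)⁻¹ / 8 * stage γ x ^ 2)) := by
  obtain ⟨D, hD0, hD⟩ := exists_profile_le (a := a) hγ hn ha
  refine ⟨2 * D, by positivity, fun x hx hs => ?_⟩
  obtain ⟨k, h1, h2⟩ := exists_transition_index hs
  have h3 := hD k x hx h1 h2 k (Or.inl rfl)
  have h4 := hD k x hx h1 h2 (k + 1) (Or.inr rfl)
  linarith [norm_stagedSpinor_le_profile (a := a) hα hne h1 h2]

lemma norm_stagedSpinor_outer_le (hα : IsDiracMatrices n α) (hn : 2 ≤ n)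
    (ha : ‖a‖ = 1) (hne : ‖e‖ = 1) {x : EuclideanSpace ℝ (Fin n)} (hx : x ≠ 0)
    (hs : stage γ x ≤ 1) : ‖stagedSpinor α e γ a x‖ ≤ n * (‖x‖ ^ n)⁻¹ := by
  rw [stagedSpinor_outer hs, norm_slash hα, norm_stageSpinor hα hne, mul_one]
  exact norm_dipoleField_le hn ha hx

lemma norm_slash_comp_le (hα : IsDiracMatrices n α) {v : Spinor n} (hv : ‖v‖ = 1)
    (L : EuclideanSpace ℝ (Fin n) →L[ℝ] EuclideanSpace ℝ (Fin n)) :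
    ‖(slash α v).comp L‖ ≤ ‖L‖ := by
  refine ContinuousLinearMap.opNorm_le_bound _ (norm_nonneg _) fun w => ?_
  rw [ContinuousLinearMap.comp_apply, norm_slash hα, hv, mul_one]
  exact L.le_opNorm w

/-- Every negative power of `|x|` is absorbed by Gaussian decay in the stage. -/
lemma exists_norm_rpow_neg_mul_exp_le (hγ : 1 < γ) (p : ℝ) :
    ∃ C : ℝ, 0 < C ∧ ∀ x : EuclideanSpace ℝ (Fin n), x ≠ 0 → 1 ≤ stage γ x →
      ‖x‖ ^ (-p) * Real.exp (-((γ - 1)⁻¹ / 8 * stage γ x ^ 2)) ≤ C := by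
  have hδ : 0 < (γ - 1)⁻¹ := inv_pos.2 (by linarith)
  set N := ⌈p * (γ - 1)⁻¹⌉₊
  refine ⟨Real.exp p * (N.factorial / ((γ - 1)⁻¹ / 8) ^ N), by positivity, fun x hx hs => ?_⟩
  have h1 : ‖x‖ ^ (-p) = Real.exp p * Real.exp (p * (γ - 1)⁻¹ * Real.log (stage γ x)) := by
    rw [Real.rpow_def_of_pos (norm_pos_iff.2 hx)]
    nth_rewrite 1 [norm_eq_exp_log_stage hγ hx]
    rw [Real.log_exp, ← Real.exp_add]
    congr 1
    ring
  rw [h1, mul_assoc]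
  gcongr
  refine le_trans ?_ (pow_mul_exp_neg_le (by positivity : 0 < (γ - 1)⁻¹ / 8) N hs)
  gcongr
  exact exp_mul_log_le_pow hs

lemma exists_norm_fderiv_stagedSpinor_le (hα : IsDiracMatrices n α) (hγ : 1 < γ) (hn : 2 ≤ n)
    (ha : ‖a‖ = 1) (hne : ‖e‖ = 1) :
    ∃ G : ℝ, 0 < G ∧ ∀ x : EuclideanSpace ℝ (Fin n), x ≠ 0 →
      (1 ≤ stage γ x → ‖fderiv ℝ (stagedSpinor α e γ a) x‖ ≤ G) ∧
      (stage γ x ≤ 1 → ‖x‖ ^ (n + 1) * ‖fderiv ℝ (stagedSpinor α e γ a) x‖ ≤ G) := by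
  obtain ⟨M, hM0, hM⟩ := exists_abs_deriv_weight_le
  obtain ⟨D, hD0, hD⟩ := exists_profile_le (a := a) hγ hn ha
  obtain ⟨G, hG0, hG⟩ := exists_amplitude_mul_norm_fderiv_le hγ hn
  obtain ⟨C, hC0, hC⟩ := exists_norm_rpow_neg_mul_exp_le (n := n) hγ γ
  have hγ1 : 0 < γ - 1 := by linarith
  refine ⟨2 * (G + M * (γ - 1) * D * C) + (n ^ 2 + 5 * n), by positivity,
    fun x hx => ⟨fun hs => ?_, fun hs => ?_⟩⟩
  all_goals
    choose L hL hL1 hL2 hL3 using fun k => exists_hasFDerivAt_stageField hn ha k hx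
    obtain ⟨g, hg, hgn⟩ := exists_hasFDerivAt_stage hγ hx
  · obtain ⟨k, h1, h2⟩ := exists_transition_index hs
    have key : ∀ j, j = k ∨ j = k + 1 →
        ‖(slash α (stageSpinor α e j)).comp (stageVecDeriv γ a j x (L j) g)‖ ≤
          G + M * (γ - 1) * D * C := by
      intro j hj
      refine (norm_slash_comp_le hα (norm_stageSpinor hα hne j) _).trans
        ((norm_stageVecDeriv_le hM j x (L j) g).trans
          (add_le_add (hG k x hx h1 h2 j hj (L j) (hL2 j) (hL3 j)) ?_))
      calc M * ‖g‖ * profile γ a j x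
          ≤ M * ((γ - 1) * ‖x‖ ^ (-γ)) *
              (D * Real.exp (-((γ - 1)⁻¹ / 8 * stage γ x ^ 2))) := by
            have := profile_nonneg (γ := γ) (a := a) j x
            gcongr
            exact hD k x hx h1 h2 j hj
        _ = M * (γ - 1) * D *
              (‖x‖ ^ (-γ) * Real.exp (-((γ - 1)⁻¹ / 8 * stage γ x ^ 2))) := by ring
        _ ≤ _ := by
            gcongr
            exact hC x hx hs
    rw [(hasFDerivAt_stagedSpinor_transition hx h1 h2 hL hg).fderiv]
    refine (norm_add_le _ _).trans ?_
    have hn2 : (0 : ℝ) ≤ n ^ 2 + 5 * n := by positivity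
    linarith [key k (Or.inl rfl), key (k + 1) (Or.inr rfl)]
  · rw [(hasFDerivAt_stagedSpinor_outer hx hs hL hg).fderiv]
    have h3 := mul_le_mul_of_nonneg_left (norm_slash_comp_le hα (norm_stageSpinor hα hne 0) (L 0))
      (by positivity : 0 ≤ ‖x‖ ^ (n + 1))
    have h4 : 0 ≤ 2 * (G + M * (γ - 1) * D * C) := by positivity
    linarith [hL2 0 rfl]

/-- The Dirac operator only sees the derivatives of the cutoffs, that is of the stage function. -/
lemma exists_norm_diracOp_stagedSpinor_le (hα : IsDiracMatrices n α) (hγ : 1 < γ) (hn : 2 ≤ n)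
    (hn3 : n ≤ 3) (ha : ‖a‖ = 1) (hne : ‖e‖ = 1)
    (he : inner ℂ e (gammaOp α (Fin.last n) e) = 0) :
    ∃ C : ℝ, 0 < C ∧ ∀ x : EuclideanSpace ℝ (Fin n), x ≠ 0 →
      (1 ≤ stage γ x → ‖diracOp α (stagedSpinor α e γ a) x‖ ≤
        C * ‖x‖ ^ (-γ) * ‖stagedSpinor α e γ a x‖) ∧
      (stage γ x ≤ 1 → diracOp α (stagedSpinor α e γ a) x = 0) := by
  obtain ⟨M, hM0, hM⟩ := exists_abs_deriv_weight_le
  obtain ⟨K, hK1, hK⟩ := exists_profile_comparable (a := a) hγ hn hn3 ha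
  have hγ1 : 0 < γ - 1 := by linarith
  refine ⟨M * (γ - 1) * (K + 3), by positivity, fun x hx => ⟨fun hs => ?_, fun hs => ?_⟩⟩
  all_goals
    choose L hL hL1 hL2 hL3 using fun k => exists_hasFDerivAt_stageField hn ha k hx
    obtain ⟨g, hg, hgn⟩ := exists_hasFDerivAt_stage hγ hx
  · obtain ⟨k, h1, h2⟩ := exists_transition_index hs
    obtain ⟨hK2, hK3⟩ := hK k x hx h1 h2
    have key : ∀ j, ‖∑ i : Fin n, gammaOp α i.castSucc (slash α (stageSpinor α e j)
        (stageVecDeriv γ a j x (L j) g (EuclideanSpace.single i 1)))‖ ≤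
          M * ((γ - 1) * ‖x‖ ^ (-γ)) * profile γ a j x := by
      intro j
      simp only [stageVecDeriv]
      rw [sum_gammaOp_slash_smul hα _ _ (hL1 j), norm_slash hα, norm_slash hα,
        norm_stageSpinor hα hne, mul_one, LinearIsometryEquiv.norm_map, norm_smul, norm_mul,
        Real.norm_of_nonneg (amplitude_pos _ _).le, profile, Real.norm_eq_abs]
      have hc := (amplitude_pos (γ - 1)⁻¹ j).le
      calc _ ≤ amplitude (γ - 1)⁻¹ j * M * ((γ - 1) * ‖x‖ ^ (-γ)) * ‖stageField a j x‖ := by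
            gcongr
            exact hM _ _
        _ = _ := by ring
    rw [(hasFDerivAt_stagedSpinor_transition hx h1 h2 hL hg).diracOp, norm_smul]
    simp only [add_apply, ContinuousLinearMap.comp_apply, map_add, Finset.sum_add_distrib]
    rw [norm_neg, Complex.norm_I, one_mul]
    calc _ ≤ M * ((γ - 1) * ‖x‖ ^ (-γ)) * profile γ a k x +
          M * ((γ - 1) * ‖x‖ ^ (-γ)) * profile γ a (k + 1) x :=
          (norm_add_le _ _).trans (add_le_add (key k) (key (k + 1)))
      _ = M * ((γ - 1) * ‖x‖ ^ (-γ)) * (profile γ a k x + profile γ a (k + 1) x) := by ring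
      _ ≤ M * ((γ - 1) * ‖x‖ ^ (-γ)) * ((K + 3) * ‖stagedSpinor α e γ a x‖) := by
          gcongr
          exact profile_add_profile_le hα hne he h1 h2 hK2 hK3 hK1
      _ = _ := by ring
  · rw [(hasFDerivAt_stagedSpinor_outer hx hs hL hg).diracOp]
    have h := sum_gammaOp_slash_smul hα (stageSpinor α e 0) 1 (hL1 0) 0 0
    simp only [one_smul, ContinuousLinearMap.zero_smulRight, add_zero, map_zero] at h
    simp only [ContinuousLinearMap.comp_apply, h, smul_zero]

/-- At the origin only stage `0` is present, and `dipoleField a 0 = 0` since `0⁻¹ = 0`. -/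
lemma stagedSpinor_zero (hγ : 1 < γ) : stagedSpinor α e γ a 0 = 0 := by
  have h : stage γ (0 : EuclideanSpace ℝ (Fin n)) ≤ 1 := by
    rw [stage]
    apply Real.exp_le_one_iff.2
    simp
    linarith
  rw [stagedSpinor_outer h]
  simp [dipoleField]

lemma hasFDerivAt_stagedSpinor_zero (hα : IsDiracMatrices n α) (hγ : 1 < γ) (hn : 2 ≤ n)
    (ha : ‖a‖ = 1) (hne : ‖e‖ = 1) :
    HasFDerivAt (stagedSpinor α e γ a) (0 : EuclideanSpace ℝ (Fin n) →L[ℝ] Spinor n) 0 := by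
  obtain ⟨D, hD0, hD⟩ := exists_norm_stagedSpinor_le (a := a) hα hγ hn ha hne
  obtain ⟨C, hC0, hC⟩ := exists_norm_rpow_neg_mul_exp_le (n := n) hγ 2
  refine .of_isLittleO ?_
  have hO : (fun x => stagedSpinor α e γ a x - stagedSpinor α e γ a 0 -
      (0 : EuclideanSpace ℝ (Fin n) →L[ℝ] Spinor n) (x - 0)) =O[nhds 0]
        fun x : EuclideanSpace ℝ (Fin n) => ‖x‖ ^ 2 := by
    refine Asymptotics.IsBigO.of_bound (D * C) ?_
    filter_upwards [Metric.ball_mem_nhds (0 : EuclideanSpace ℝ (Fin n)) (Real.exp_pos (-1))]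
      with x hxb
    rw [stagedSpinor_zero hγ]
    simp only [sub_zero, zero_apply]
    by_cases hx : x = 0
    · rw [hx, stagedSpinor_zero hγ]
      simp
    have hx0 : 0 < ‖x‖ := norm_pos_iff.2 hx
    have hs : 1 ≤ stage γ x := by
      by_contra! h
      exact absurd (exp_neg_one_le_norm hγ hx h.le) (not_le.2 (by simpa using hxb))
    have h1 := hD x hx hs
    have h2 := hC x hx hs
    rw [Real.rpow_neg hx0.le, Real.rpow_two, inv_mul_le_iff₀ (by positivity)] at h2
    rw [Real.norm_of_nonneg (by positivity)]
    calc _ ≤ D * (‖x‖ ^ 2 * C) := h1.trans (by gcongr)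
      _ = _ := by ring
  refine hO.trans_isLittleO ?_
  simp only [sub_zero]
  exact Asymptotics.isLittleO_norm_pow_id one_lt_two

lemma memH1_stagedSpinor (hα : IsDiracMatrices n α) (hγ : 1 < γ) (hn : 2 ≤ n)
    (ha : ‖a‖ = 1) (hne : ‖e‖ = 1) : MemH1 (stagedSpinor α e γ a) := by
  obtain ⟨D, hD0, hD⟩ := exists_norm_stagedSpinor_le (a := a) hα hγ hn ha hne
  obtain ⟨G, hG0, hG⟩ := exists_norm_fderiv_stagedSpinor_le (a := a) hα hγ hn ha hne
  have hd : Differentiable ℝ (stagedSpinor α e γ a) := by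
    intro x
    by_cases hx : x = 0
    · exact hx ▸ (hasFDerivAt_stagedSpinor_zero hα hγ hn ha hne).differentiableAt
    · exact (contDiffAt_stagedSpinor hx).differentiableAt (by simp)
  -- compare `1 + |x|` with `2` where `|x| ≤ 1 / e`, and with `(e + 1) |x|` where `1 / e ≤ |x|`
  have hin : ∀ (x : EuclideanSpace ℝ (Fin n)) (b B : ℝ), x ≠ 0 → 1 ≤ stage γ x → 0 ≤ B → b ≤ B →
      (1 + ‖x‖) ^ n * b ≤ 2 ^ n * B := by
    intro x b B hx hs hB hb
    have h1 : ‖x‖ ≤ 1 := (norm_le_of_one_le_stage hγ hx hs).trans (by simp)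
    have h2 : 1 + ‖x‖ ≤ 2 := by linarith
    exact mul_le_mul_of_nonneg_left hb (by positivity) |>.trans (by gcongr)
  have hout : ∀ (x : EuclideanSpace ℝ (Fin n)), x ≠ 0 → stage γ x ≤ 1 →
      (1 + ‖x‖) ^ n ≤ (Real.exp 1 + 1) ^ n * ‖x‖ ^ n := by
    intro x hx hs
    have h1 : 1 ≤ Real.exp 1 * ‖x‖ := by
      have := mul_le_mul_of_nonneg_left (exp_neg_one_le_norm hγ hx hs) (Real.exp_pos 1).le
      rwa [← Real.exp_add, add_neg_cancel, Real.exp_zero] at this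
    rw [← mul_pow]
    gcongr
    linarith
  set E : ℝ := (Real.exp 1 + 1) ^ n
  have hE : 0 < E := by positivity
  set C : ℝ := 2 ^ n * D + 2 ^ n * G + E * n + E * Real.exp 1 * G with hC
  have c1 : 0 < 2 ^ n * D := by positivity
  have c2 : 0 < 2 ^ n * G := by positivity
  have c3 : 0 ≤ E * n := by positivity
  have c4 : 0 < E * Real.exp 1 * G := by positivity
  refine memH1_of_differentiable (C := C) (by omega) hd (fun x => ?_) fun x => ?_
  · by_cases hx : x = 0
    · rw [hx, stagedSpinor_zero hγ, norm_zero]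
      positivity
    have hx0 : 0 < ‖x‖ := norm_pos_iff.2 hx
    rw [← div_eq_mul_inv, le_div_iff₀ (by positivity), mul_comm]
    rcases le_total 1 (stage γ x) with hs | hs
    · have h1 : ‖stagedSpinor α e γ a x‖ ≤ D :=
        (hD x hx hs).trans (mul_le_of_le_one_right hD0.le (Real.exp_le_one_iff.2 (by
          have : 0 < (γ - 1)⁻¹ := inv_pos.2 (by linarith)
          have : 0 ≤ (γ - 1)⁻¹ / 8 * stage γ x ^ 2 := by positivity
          linarith)))
      linarith [hin x _ D hx hs hD0.le h1]
    · have h1 := norm_stagedSpinor_outer_le (a := a) hα hn ha hne hx hs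
      have h2 : (1 + ‖x‖) ^ n * ‖stagedSpinor α e γ a x‖ ≤ E * n := by
        calc _ ≤ E * ‖x‖ ^ n * (n * (‖x‖ ^ n)⁻¹) := by
              gcongr
              exact hout x hx hs
          _ = E * n := by field_simp
      linarith
  · by_cases hx : x = 0
    · rw [hx, (hasFDerivAt_stagedSpinor_zero hα hγ hn ha hne).fderiv, norm_zero]
      positivity
    have hx0 : 0 < ‖x‖ := norm_pos_iff.2 hx
    rw [← div_eq_mul_inv, le_div_iff₀ (by positivity), mul_comm]
    rcases le_total 1 (stage γ x) with hs | hs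
    · linarith [hin x _ G hx hs hG0.le ((hG x hx).1 hs)]
    · have h1 := (hG x hx).2 hs
      have h3 : 1 ≤ Real.exp 1 * ‖x‖ := by
        have := mul_le_mul_of_nonneg_left (exp_neg_one_le_norm hγ hx hs) (Real.exp_pos 1).le
        rwa [← Real.exp_add, add_neg_cancel, Real.exp_zero] at this
      set f := ‖fderiv ℝ (stagedSpinor α e γ a) x‖
      have hf : 0 ≤ f := norm_nonneg _
      have h2 : (1 + ‖x‖) ^ n * f ≤ E * Real.exp 1 * G := by
        calc _ ≤ E * ‖x‖ ^ n * f := by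
              gcongr
              exact hout x hx hs
          _ ≤ E * ‖x‖ ^ n * f * (Real.exp 1 * ‖x‖) := le_mul_of_one_le_right (by positivity) h3
          _ = E * Real.exp 1 * (‖x‖ ^ (n + 1) * f) := by ring
          _ ≤ _ := by gcongr
      linarith

end Estimates

theorem theorem1p4 (γ : ℝ) (hγ : 1 < γ) (n : ℕ) (hn : n = 2 ∨ n = 3)
    (α : Fin (n + 1) → Matrix (Fin (spinorDim n)) (Fin (spinorDim n)) ℂ)
    (hα : IsDiracMatrices n α) :
    ∃ u : EuclideanSpace ℝ (Fin n) → Spinor n,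
      MemH1 u ∧ ContDiffOn ℝ ∞ u {0}ᶜ ∧
      (∀ r : ℝ, 0 < r → ∃ x : EuclideanSpace ℝ (Fin n), x ≠ 0 ∧ ‖x‖ < r ∧ u x ≠ 0) ∧
      ∃ C₁ C₂ C₃ : ℝ, 0 < C₁ ∧ 0 < C₂ ∧ 0 < C₃ ∧
        ∀ x : EuclideanSpace ℝ (Fin n), x ≠ 0 →
          ‖u x‖ ≤ C₁ * Real.exp (-(C₂ / ‖x‖ ^ (2 * γ - 2))) ∧
          (n = 2 → ‖diracOp α u x‖ ≤ C₃ * ‖x‖ ^ (-γ) * ‖u x‖) ∧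
          (n = 3 → ‖diracOp α u x‖ ≤ C₃ * ‖x‖ ^ (-γ) * |Real.log ‖x‖| ^ 3 * ‖u x‖) := by
  have hn2 : 2 ≤ n := by omega
  have hn3 : n ≤ 3 := by omega
  obtain ⟨e, hne, he⟩ := exists_inner_gammaOp_last_eq_zero hα (by omega)
  obtain ⟨a, ha⟩ : ∃ a : EuclideanSpace ℝ (Fin n), ‖a‖ = 1 :=
    ⟨EuclideanSpace.single ⟨0, by omega⟩ 1, by simp⟩
  obtain ⟨D, hD0, hD⟩ := exists_norm_stagedSpinor_le (a := a) hα hγ hn2 ha hne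
  obtain ⟨C, hC0, hC⟩ := exists_norm_diracOp_stagedSpinor_le (a := a) hα hγ hn2 hn3 ha hne he
  obtain ⟨K, hK1, hK⟩ := exists_profile_comparable (a := a) hγ hn2 hn3 ha
  have hδ : 0 < (γ - 1)⁻¹ := inv_pos.2 (by linarith)
  set c : ℝ := (γ - 1)⁻¹ / 8 with hc
  have hc0 : 0 < c := by positivity
  refine ⟨stagedSpinor α e γ a, memH1_stagedSpinor hα hγ hn2 ha hne,
    fun x hx => (contDiffAt_stagedSpinor hx).contDiffWithinAt, fun r hr => ?_,
    D + n * Real.exp n * Real.exp c, c / Real.exp (2 * (γ - 1)), C, by positivity, by positivity,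
    hC0, fun x hx => ⟨?_, fun _ => ?_, fun _ => ?_⟩⟩
  · set t : ℝ := min (r / 2) (Real.exp (-1) / 2)
    have ht : 0 < t := by positivity
    have hnorm : ‖t • a‖ = t := by rw [norm_smul, ha, mul_one, Real.norm_of_nonneg ht.le]
    have hx : t • a ≠ 0 := norm_pos_iff.1 (by rw [hnorm]; exact ht)
    have hs : 1 ≤ stage γ (t • a) := by
      by_contra! h
      have h1 := exp_neg_one_le_norm hγ hx h.le
      rw [hnorm] at h1
      linarith [min_le_right (r / 2) (Real.exp (-1) / 2), Real.exp_pos (-1)]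
    refine ⟨t • a, hx, by rw [hnorm]; linarith [min_le_left (r / 2) (Real.exp (-1) / 2)], ?_⟩
    obtain ⟨k, h1, h2⟩ := exists_transition_index hs
    obtain ⟨hK2, hK3⟩ := hK k _ hx h1 h2
    have h3 := profile_add_profile_le hα hne he h1 h2 hK2 hK3 hK1
    have h4 := profile_pos (γ := γ) hn2 hn3 ha k hx
    have h5 := profile_nonneg (γ := γ) (a := a) (k + 1) (t • a)
    intro h0
    rw [h0, norm_zero, mul_zero] at h3
    linarith
  · have hexp : c / Real.exp (2 * (γ - 1)) / ‖x‖ ^ (2 * γ - 2) = c * stage γ x ^ 2 := by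
      rw [div_eq_mul_inv _ (‖x‖ ^ (2 * γ - 2)), norm_rpow_eq_stage hx]
      field_simp
    rw [hexp, add_mul]
    have hp : 0 ≤ n * Real.exp n * Real.exp c * Real.exp (-(c * stage γ x ^ 2)) := by positivity
    have hp' : 0 ≤ D * Real.exp (-(c * stage γ x ^ 2)) := by positivity
    rcases le_total 1 (stage γ x) with hs | hs
    · linarith [hD x hx hs]
    · have h1 := norm_stagedSpinor_outer_le (a := a) hα hn2 ha hne hx hs
      have h2 : (‖x‖ ^ n)⁻¹ ≤ Real.exp n := by
        have h3 := pow_le_pow_left₀ (Real.exp_pos _).le (exp_neg_one_le_norm hγ hx hs) n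
        rw [← Real.exp_nat_mul] at h3
        rw [inv_le_comm₀ (pow_pos (norm_pos_iff.2 hx) n) (Real.exp_pos _), ← Real.exp_neg]
        simpa using h3
      have h4 : 1 ≤ Real.exp c * Real.exp (-(c * stage γ x ^ 2)) := by
        rw [← Real.exp_add]
        apply Real.one_le_exp
        have := pow_le_one₀ (n := 2) (stage_pos γ x).le hs
        nlinarith
      have h5 : (n : ℝ) * (‖x‖ ^ n)⁻¹ ≤ n * Real.exp n := by gcongr
      have h6 : n * Real.exp n ≤ n * Real.exp n * (Real.exp c * Real.exp (-(c * stage γ x ^ 2))) :=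
        le_mul_of_one_le_right (by positivity) h4
      linarith
  · rcases le_total 1 (stage γ x) with hs | hs
    · exact (hC x hx).1 hs
    · rw [(hC x hx).2 hs, norm_zero]
      positivity
  · rcases le_total 1 (stage γ x) with hs | hs
    · refine ((hC x hx).1 hs).trans ?_
      -- all transitions take place in `|x| ≤ 1 / e`, where the logarithm is at least `1`
      have h1 : 1 ≤ |Real.log ‖x‖| := by
        have h2 := Real.log_le_log (norm_pos_iff.2 hx) (norm_le_of_one_le_stage hγ hx hs)
        rw [Real.log_exp] at h2
        rw [abs_of_nonpos (by linarith)]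
        linarith
      have h3 : 1 ≤ |Real.log ‖x‖| ^ 3 := one_le_pow₀ h1
      rw [mul_right_comm (C * ‖x‖ ^ (-γ)) (|Real.log ‖x‖| ^ 3)]
      exact le_mul_of_one_le_right (by positivity) h3
    · rw [(hC x hx).2 hs, norm_zero]
      positivity
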